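/- Let $\mathbb R^m_s$ be $\mathbb R^m$ with $\langle X,Y\rangle_s=-\sum_{i\le s}x_iy_i+\sum_{i>s}x_iy_i$. Let $n\ge 2$, $c\in\{0,1,-1\}$, and let $M^{n+1}_1(c)$ be the Lorentzian space form $\mathbb R^{n+1}_1$ ($c=0$), $\{u\in\mathbb R^{n+2}_1:\langle u,u\rangle_1=1\}$ ($c=1$), $\{u\in\mathbb R^{n+2}_2:\langle u,u\rangle_2=-1\}$ ($c=-1$). Let $\sigma_c$ be the map from $M^{n+1}_1(c)$ to the light cone of $\mathbb R^{n+3}_2$ given by $u\mapsto(\frac{\langle u,u\rangle+1}2,u,\frac{\langle u,u\rangle-1}2)$, $u\mapsto(1,u)$, $u\mapsto(u,1)$ for $c=0,1,-1$ respectively. Let $x:M^n\to M^{n+1}_1(c)$ be a smooth spacelike hypersurface. For a unit normal vector $e$ at $p$ (so $\langle e,e\rangle=-1$), with first and second fundamental forms $I$, $II$, a principal vector is a nonzero $X\in T_pM$ with $II(X,\cdot)=\lambda\, I(X,\cdot)$, and $\lambda$ is its principal curvature; $p$ is umbilical if $II$ is a multiple of $I$ at $p$. Put $y=\sigma_c\circ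 x$ and $$g=-(\langle\Delta y,\Delta y\rangle_2-n^2\kappa)\langle dy,dy\rangle_2,$$ where $\Delta$ and $\kappa$ are the Laplace operator and the normalized scalar curvature of the metric $\langle dy,dy\rangle_2$. At non-umbilical points $g$ is positive definite (the conformal metric). Let $Y$ be the positive multiple of $y$ with $\langle dY,dY\rangle_2=g$, let $N=-\frac1n\Delta_gY-\frac1{2n^2}\langle\Delta_gY,\Delta_gY\rangle_2Y$, and let $\xi$ be the vector orthogonal to $Y$, $N$, $dY$ with $\langle\xi,\xi\rangle_2=-1$ and $\langle\xi,d\sigma_c(e)\rangle_2<0$ (so $e$ fixes the sign of $\xi$). The conformal second fundamental form is $B(X,Z)=-\langle D^2Y(X,Z),\xi\rangle_2$, i.e. the coefficient of $\xi$ in the second derivative of $Y$. The conformal principal curvatures are its eigenvalues $b$ with respect to $g$: $B(X,\cdot)=b\,g(X,\cdot)$ with $X\ne0$. Let $\phi$ be a conformal transformation of $M^{n+1}_1(c)$, possibly defined only on an open part of it containing $x(M)$: a smooth map into $M^{n+1}_1(c)$ such that $\langle d\phi(v),d\phi(w)\rangle=\rho^2\langle v,w\rangle$ for all tangent vectors $v,w$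 at each point, where $\rho>0$ depends on the point. Then $\phi\circ x$ is a spacelike hypersurface, and at every $p\in M$: (1) $X\in T_pM$ is a principal vector of $x$ if and only if it is a principal vector of $\phi\circ x$. (2) If $p$ is not an umbilical point of $x$, then it is not one of $\phi\circ x$. Moreover, for every unit normal $e$ of $x$ at $p$ there is $r>0$ such that $r\,d\phi(e)$ is a unit normal of $\phi\circ x$ at $p$ and, with respect to the unit normals $e$ and $r\,d\phi(e)$, the conformal principal curvatures of $x$ and $\phi\circ x$ at $p$ and their eigenvectors are the same. (3) Let $e$, $e'$ be any unit normals of $x$ and $\phi\circ x$ at $p$, and let $v_1,\dots,v_n$ be principal vectors of $x$ at $p$ with principal curvatures $\lambda_1,\dots,\lambda_n$ with respect to $e$. Then $v_1,\dots,v_n$ are principal vectors of $\phi\circ x$ with principal curvatures $\lambda'_1,\dots,\lambda'_n$ with respect to $e'$, one has $\lambda_i\ne\lambda_k$ if and only if $\lambda_i'\ne\lambda_k'$, and the Möbius curvatures agree: $$\frac{\lambda_i-\lambda_j}{\lambda_i-\lambda_k}=\frac{\lambda'_i-\lambda'_j}{\lambda'_i-\lambda'_k}\qquad\text{whenever }\lambda_i\neq\lambda_k.$$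 -/

import Mathlib

open scoped Manifold ContDiff

noncomputable section

namespace LorentzConformal

/-! ## Pseudo-Euclidean spaces and Lorentzian space forms -/

/-- The scalar product `⟨X, Y⟩ₛ = - ∑_{i ≤ s} xᵢ yᵢ + ∑_{i > s} xᵢ yᵢ` of `ℝᵐₛ`. -/
def pseudoInner (s : ℕ) {m : ℕ} (X Y : Fin m → ℝ) : ℝ :=
  ∑ i : Fin m, (if (i : ℕ) < s then (-1 : ℝ) else 1) * X i * Y i

/-- Dimension of the pseudo-Euclidean space that contains the `(n+1)`-dimensional Lorentzian space
form of curvature `c ∈ {0, 1, -1}`. -/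
def ambientDim (c : SignType) (n : ℕ) : ℕ :=
  match c with
  | .zero => n + 1
  | .pos => n + 2
  | .neg => n + 2

/-- Index of the pseudo-Euclidean space that contains the space form of curvature `c`. -/
def ambientIndex (c : SignType) : ℕ :=
  match c with
  | .zero => 1
  | .pos => 1
  | .neg => 2

/-- `ℝⁿ⁺¹₁`, `ℝⁿ⁺²₁`, `ℝⁿ⁺²₂` for `c = 0, 1, -1`. -/
abbrev Ambient (c : SignType) (n : ℕ) : Type := Fin (ambientDim c n) → ℝ

/-- The scalar product of the ambient space; it restricts to the metric of the space form. -/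
def ambientInner (c : SignType) {n : ℕ} (u v : Ambient c n) : ℝ :=
  pseudoInner (ambientIndex c) u v

/-- The Lorentzian space form `Mⁿ⁺¹₁(c)`: the Minkowski space `ℝⁿ⁺¹₁` for `c = 0`, the de Sitter
space `{⟨u, u⟩₁ = 1}` for `c = 1`, the anti-de Sitter space `{⟨u, u⟩₂ = -1}` for `c = -1`. -/
def spaceForm (c : SignType) (n : ℕ) : Set (Ambient c n) :=
  match c with
  | .zero => Set.univ
  | .pos => {u | ambientInner .pos u u = 1}
  | .neg => {u | ambientInner .neg u u = -1}

/-- The tangent space of `Mⁿ⁺¹₁(c)` at the point `u`, as a set of ambient vectors. -/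
def spaceFormTangent (c : SignType) {n : ℕ} (u : Ambient c n) : Set (Ambient c n) :=
  match c, u with
  | .zero, _ => Set.univ
  | .pos, u => {v | ambientInner .pos u v = 0}
  | .neg, u => {v | ambientInner .neg u v = 0}

/-- The lift to the light cone of `ℝⁿ⁺³₂` of the conformal embedding of `Mⁿ⁺¹₁(c)` in the projective
light cone: `u ↦ ((⟨u,u⟩+1)/2, u, (⟨u,u⟩-1)/2)`, `u ↦ (1, u)`, `u ↦ (u, 1)` for `c = 0, 1, -1`. -/
def coneLift (c : SignType) {n : ℕ} (u : Ambient c n) : Fin (n + 3) → ℝ :=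
  match c, u with
  | .zero, u => Fin.cons (α := fun _ => ℝ) ((ambientInner .zero u u + 1) / 2)
      (Fin.snoc (α := fun _ => ℝ) (n := n + 1) u ((ambientInner .zero u u - 1) / 2))
  | .pos, u => Fin.cons (α := fun _ => ℝ) (n := n + 2) 1 u
  | .neg, u => Fin.snoc (α := fun _ => ℝ) (n := n + 2) u 1

/-- `φ` is a smooth conformal map from the open part `U ∩ Mⁿ⁺¹₁(c)` of `Mⁿ⁺¹₁(c)` to `Mⁿ⁺¹₁(c)`.
Smooth maps on open parts of `Mⁿ⁺¹₁(c)` are given by smooth maps on open sets of the ambient space;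
only the restriction to `Mⁿ⁺¹₁(c)` matters. Conformal transformations of `Mⁿ⁺¹₁(c)`, whether defined
everywhere or (as those induced by `O(n+3,2)`) on an open part only, are of this kind. -/
structure IsConformalMapOn (c : SignType) {n : ℕ} (U : Set (Ambient c n))
    (φ : Ambient c n → Ambient c n) : Prop where
  isOpen : IsOpen U
  contDiffOn : ContDiffOn ℝ ∞ φ U
  mapsTo : Set.MapsTo φ (U ∩ spaceForm c n) (spaceForm c n)
  conformal : ∀ u ∈ U ∩ spaceForm c n, ∃ ρ : ℝ, 0 < ρ ∧
    ∀ v ∈ spaceFormTangent c u, ∀ w ∈ spaceFormTangent c u,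
      ambientInner c (fderiv ℝ φ u v) (fderiv ℝ φ u w) = ρ ^ 2 * ambientInner c v w

/-! ## Riemannian geometry in a coordinate domain of `ℝⁿ` -/

/-- The coordinate space of an `n`-dimensional manifold. -/
abbrev Coord (n : ℕ) : Type := EuclideanSpace ℝ (Fin n)

section Coordinates

variable {n : ℕ} {W : Type*} [NormedAddCommGroup W] [NormedSpace ℝ W]

/-- The partial derivative `∂ᵢ F`. -/
def pd (i : Fin n) (F : Coord n → W) (u : Coord n) : W :=
  fderiv ℝ F u (EuclideanSpace.single i 1)

/-- The second derivative `D²F(u)(X, Z)`. -/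
def hess (F : Coord n → W) (u X Z : Coord n) : W :=
  fderiv ℝ (fun v => fderiv ℝ F v Z) u X

/-- The coordinate matrix `(g_ij)` of a field `g` of bilinear forms. -/
def gram (g : Coord n → Coord n → Coord n → ℝ) (u : Coord n) : Matrix (Fin n) (Fin n) ℝ :=
  Matrix.of fun i j => g u (EuclideanSpace.single i 1) (EuclideanSpace.single j 1)

/-- The Christoffel symbol `Γᵏ_ij` of the Levi-Civita connection of `g`. -/
def christoffel (g : Coord n → Coord n → Coord n → ℝ) (k i j : Fin n) (u : Coord n) : ℝ :=
  (1 / 2) * ∑ l, (gram g u)⁻¹ k l *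
    (pd i (fun v => gram g v j l) u + pd j (fun v => gram g v i l) u
      - pd l (fun v => gram g v i j) u)

/-- The Laplace operator of `g` (trace of the covariant Hessian), on vector-valued functions. -/
def laplacian (g : Coord n → Coord n → Coord n → ℝ) (F : Coord n → W) (u : Coord n) : W :=
  ∑ i, ∑ j, (gram g u)⁻¹ i j •
    (pd i (fun v => pd j F v) u - ∑ k, christoffel g k i j u • pd k F u)

/-- The Ricci curvature `R_jk` of `g`. -/
def ricci (g : Coord n → Coord n → Coord n → ℝ) (j k : Fin n) (u : Coord n) : ℝ :=
  ∑ i, (pd i (christoffel g i j k) u - pd j (christoffel g i i k) u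
    + ∑ m, (christoffel g i i m u * christoffel g m j k u
      - christoffel g i j m u * christoffel g m i k u))

/-- The normalized scalar curvature of `g` (equal to `1` for the unit sphere). -/
def normalizedScalarCurvature (g : Coord n → Coord n → Coord n → ℝ) (u : Coord n) : ℝ :=
  (∑ j, ∑ k, (gram g u)⁻¹ j k * ricci g j k u) / ((n : ℝ) * ((n : ℝ) - 1))

/-- The pull-back by `F` of the scalar product of `ℝᵐₛ`. -/
def inducedMetric (s : ℕ) {m : ℕ} (F : Coord n → Fin m → ℝ) (u X Z : Coord n) : ℝ :=
  pseudoInner s (fderiv ℝ F u X) (fderiv ℝ F u Z)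

end Coordinates

/-! ## Spacelike hypersurfaces: isometric invariants -/

section Hypersurface

variable (c : SignType) {n : ℕ} {M : Type*} [TopologicalSpace M] [ChartedSpace (Coord n) M]
  (x : M → Ambient c n) (p : M)

/-- The differential of the hypersurface, on `T_p M`. -/
def differential (X : TangentSpace (𝓡 n) p) : Ambient c n :=
  mfderiv (𝓡 n) 𝓘(ℝ, Ambient c n) x p X

/-- `x : Mⁿ → Mⁿ⁺¹₁(c)` is a smooth spacelike (hence immersed) hypersurface. -/
structure IsSpacelikeHypersurface : Prop where
  contMDiff : ContMDiff (𝓡 n) 𝓘(ℝ, Ambient c n) ∞ x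
  mem : ∀ p, x p ∈ spaceForm c n
  spacelike : ∀ p, ∀ X : TangentSpace (𝓡 n) p, X ≠ 0 →
    0 < ambientInner c (differential c x p X) (differential c x p X)

/-- The expression of `x` in the preferred chart at `p`, the chart by which `T_p M` is identified
with `ℝⁿ`. -/
def chartRep : Coord n → Ambient c n := fun u => x ((extChartAt (𝓡 n) p).symm u)

/-- The point `p` in the preferred chart at `p`. -/
def basePoint (n : ℕ) {M : Type*} [TopologicalSpace M] [ChartedSpace (Coord n) M] (p : M) :
    Coord n :=
  extChartAt (𝓡 n) p p

/-- The first fundamental form `I = ⟨dx, dx⟩`. -/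
def firstForm (X Z : TangentSpace (𝓡 n) p) : ℝ :=
  ambientInner c (differential c x p X) (differential c x p Z)

/-- `e` is a unit normal vector at `p` of `x`: tangent to `Mⁿ⁺¹₁(c)`, orthogonal to the
hypersurface, `⟨e, e⟩ = -1`. -/
structure IsUnitNormal (e : Ambient c n) : Prop where
  tangent : e ∈ spaceFormTangent c (x p)
  orthogonal : ∀ X : TangentSpace (𝓡 n) p, ambientInner c e (differential c x p X) = 0
  unit : ambientInner c e e = -1

/-- The second fundamental form with respect to the unit normal `e`: as `⟨e, e⟩ = -1`, this is the
coefficient `h(X, Z)` of `e` in the normal part `h(X, Z) e` of the second derivative of `x`. -/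
def secondForm (e : Ambient c n) (X Z : TangentSpace (𝓡 n) p) : ℝ :=
  -ambientInner c (hess (chartRep c x p) (basePoint n p) X Z) e

/-- `X` is a principal vector with principal curvature `lam` with respect to the unit normal `e`: an
eigenvector of the shape operator `A`, `I(AX, Z) = II(X, Z)`. -/
def HasPrincipalCurvature (e : Ambient c n) (X : TangentSpace (𝓡 n) p) (lam : ℝ) : Prop :=
  X ≠ 0 ∧ ∀ Z : TangentSpace (𝓡 n) p, secondForm c x p e X Z = lam * firstForm c x p X Z

/-- `X` is a principal vector of `x` at `p` (a notion that does not depend on the sign of the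
unit normal). -/
def IsPrincipalVector (X : TangentSpace (𝓡 n) p) : Prop :=
  ∃ e, IsUnitNormal c x p e ∧ ∃ lam, HasPrincipalCurvature c x p e X lam

/-- `p` is an umbilical point of `x`: the second fundamental form is a multiple of the first. -/
def IsUmbilical : Prop :=
  ∃ e, IsUnitNormal c x p e ∧ ∃ μ : ℝ, ∀ X Z : TangentSpace (𝓡 n) p,
    secondForm c x p e X Z = μ * firstForm c x p X Z

/-! ## Spacelike hypersurfaces: conformal invariants

All functions below live on the image of the preferred chart at `p`. -/

/-- The lift `y` of the hypersurface to the light cone. -/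
def lift : Coord n → Fin (n + 3) → ℝ := fun u => coneLift c (chartRep c x p u)

/-- The factor `-(⟨Δy, Δy⟩ - n² κ)`, where the Laplace operator `Δ` and the normalized scalar
curvature `κ` are those of the metric `⟨dy, dy⟩`. -/
def conformalFactor (u : Coord n) : ℝ :=
  -(pseudoInner 2 (laplacian (inducedMetric 2 (lift c x p)) (lift c x p) u)
      (laplacian (inducedMetric 2 (lift c x p)) (lift c x p) u)
    - (n : ℝ) ^ 2 * normalizedScalarCurvature (inducedMetric 2 (lift c x p)) u)

/-- The conformal metric `g = -(⟨Δy, Δy⟩ - n² κ) ⟨dy, dy⟩`. -/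
def conformalMetric (u X Z : Coord n) : ℝ :=
  conformalFactor c x p u * inducedMetric 2 (lift c x p) u X Z

/-- The conformal position vector: the multiple `Y` of the lift `y` with `⟨dY, dY⟩ = g`. -/
def conformalPosition (u : Coord n) : Fin (n + 3) → ℝ :=
  Real.sqrt (conformalFactor c x p u) • lift c x p u

/-- `N = -(1/n) ΔY - (1/(2n²)) ⟨ΔY, ΔY⟩ Y`, where `Δ` is the Laplace operator of `g`. -/
def conformalN (u : Coord n) : Fin (n + 3) → ℝ :=
  -(1 / (n : ℝ)) • laplacian (conformalMetric c x p) (conformalPosition c x p) u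
    - ((1 / (2 * (n : ℝ) ^ 2)) *
        pseudoInner 2 (laplacian (conformalMetric c x p) (conformalPosition c x p) u)
          (laplacian (conformalMetric c x p) (conformalPosition c x p) u)) •
      conformalPosition c x p u

/-- `ξ` is the unit vector, at `p`, of the conformal normal bundle: orthogonal to `Y`, `N`, `dY` and
with `⟨ξ, ξ⟩ = -1`. These conditions leave the choice of a sign, which is made according to the
unit normal `e` of `x`: `ξ` is the sum of the image of `e` in `ℝⁿ⁺³₂` and a multiple of `Y`, so it has
negative scalar product with that image. -/
structure IsConformalNormal (e : Ambient c n) (ξ : Fin (n + 3) → ℝ) : Prop where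
  orthogonal_Y : pseudoInner 2 ξ (conformalPosition c x p (basePoint n p)) = 0
  orthogonal_N : pseudoInner 2 ξ (conformalN c x p (basePoint n p)) = 0
  orthogonal_dY : ∀ X : Coord n,
    pseudoInner 2 ξ (fderiv ℝ (conformalPosition c x p) (basePoint n p) X) = 0
  unit : pseudoInner 2 ξ ξ = -1
  oriented : pseudoInner 2 ξ (fderiv ℝ (coneLift c) (x p) e) < 0

/-- The conformal second fundamental form `B` at `p` with respect to `ξ`: as `⟨ξ, ξ⟩ = -1`, this is
the coefficient of `ξ` in the second derivative of `Y`, that is `B_ij` in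
`dY_i = - ∑ A_ij ω_j Y - ω_i N + ∑ ω_ij Y_j + ∑ B_ij ω_j ξ`. -/
def conformalSecondForm (ξ : Fin (n + 3) → ℝ) (X Z : TangentSpace (𝓡 n) p) : ℝ :=
  -pseudoInner 2 (hess (conformalPosition c x p) (basePoint n p) X Z) ξ

/-- `b` is a conformal principal curvature of `x` at `p`, with eigenvector `X`: an eigenvalue
of the conformal second fundamental form with respect to the conformal metric. The unit normal `e`
fixes the sign of `B`. -/
def HasConformalPrincipalCurvature (e : Ambient c n) (X : TangentSpace (𝓡 n) p) (b : ℝ) : Prop :=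
  X ≠ 0 ∧ ∃ ξ, IsConformalNormal c x p e ξ ∧ ∀ Z : TangentSpace (𝓡 n) p,
    conformalSecondForm c x p ξ X Z = b * conformalMetric c x p (basePoint n p) X Z

end Hypersurface

/-- The Möbius curvature `(λᵢ - λⱼ) / (λᵢ - λₖ)` of principal curvatures `λ₁, …, λₙ`; it is
meaningful when `λᵢ ≠ λₖ`. -/
def mobiusCurvature {n : ℕ} (lam : Fin n → ℝ) (i j k : Fin n) : ℝ :=
  (lam i - lam j) / (lam i - lam k)

end LorentzConformal

end

noncomputable section

namespace LorentzConformal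

/-! ## Pseudo-Euclidean linear algebra -/

section PseudoInner

variable {s m : ℕ}

/-! All conformal invariants are reduced to the first form I and the second form II of x at the
single point p. The maps σ_c satisfy ⟨dσ(a), dσ(b)⟩ = ⟨a, b⟩ even when the two differentials are
taken at different points (`pseudoInner_fderiv_coneLift`). Hence the lift y = σ_c ∘ x has induced
metric I, and its second derivative has component II along dσ(e) (`inducedMetric_lift`,
`normalSecond_lift`).

Let H be the mean of the eigenvalues of II and T = II - H I its traceless part. The normal space of
y is spanned by y, dσ(e) and Δy. As y is null and ⟨D²y, y⟩ = -I, the traceless normal part of D²y is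
T dσ(e) up to a multiple of y. The twice contracted Gauss equation then shows that the conformal
factor f equals n/(n-1) times the squared I-norm of T (`IsConeImmersion.coneFactor_eq`): no
derivative of I remains, and f > 0 where p is not umbilical. The vector ξ is dσ(e) - H y
(`isConformalNormal_iff`). It is orthogonal to y and dy, so derivatives of √f do not contribute to
the ξ-component of D²Y for Y = √f y, and B = √f T.

If φ is conformal with ratio ρ at x(p), then I' = ρ² I, and the Koszul formula gives II' = ρ II + τ
I for some number τ (`IsConformalMapOn.exists_hess_comp`,
`IsConformalMapOn.exists_fundamentalForms`). Therefore T' = ρ T and f' = ρ⁻² f, so g' = f' I' = g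
and B' = √f' T' = B. Principal curvatures change by λ' = (a λ + b)/ρ² with a ≠ 0, which preserves
principal vectors and quotients of differences. Since dφ maps onto the tangent space of the space
form, every unit normal of φ ∘ x comes from one of x. No classification of conformal maps is
involved. -/

theorem pseudoInner_comm (X Y : Fin m → ℝ) : pseudoInner s X Y = pseudoInner s Y X := by
  unfold pseudoInner
  exact Finset.sum_congr rfl fun i _ => by ring

theorem pseudoInner_add_left (X X' Y : Fin m → ℝ) :
    pseudoInner s (X + X') Y = pseudoInner s X Y + pseudoInner s X' Y := by
  simp only [pseudoInner, ← Finset.sum_add_distrib, Pi.add_apply]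
  exact Finset.sum_congr rfl fun i _ => by ring

theorem pseudoInner_smul_left (a : ℝ) (X Y : Fin m → ℝ) :
    pseudoInner s (a • X) Y = a * pseudoInner s X Y := by
  simp only [pseudoInner, Finset.mul_sum, Pi.smul_apply, smul_eq_mul]
  exact Finset.sum_congr rfl fun i _ => by ring

/-- The scalar product of `ℝᵐₛ` as a bilinear form. -/
def pseudoForm (s m : ℕ) : LinearMap.BilinForm ℝ (Fin m → ℝ) :=
  LinearMap.mk₂ ℝ (pseudoInner s) pseudoInner_add_left pseudoInner_smul_left
    (fun X Y Y' => by
      rw [pseudoInner_comm, pseudoInner_add_left, pseudoInner_comm Y, pseudoInner_comm Y'])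
    (fun a X Y => by
      rw [pseudoInner_comm, pseudoInner_smul_left, pseudoInner_comm Y, smul_eq_mul])

theorem pseudoInner_add_right (X Y Y' : Fin m → ℝ) :
    pseudoInner s X (Y + Y') = pseudoInner s X Y + pseudoInner s X Y' :=
  (pseudoForm s m X).map_add Y Y'

theorem pseudoInner_smul_right (a : ℝ) (X Y : Fin m → ℝ) :
    pseudoInner s X (a • Y) = a * pseudoInner s X Y :=
  (pseudoForm s m X).map_smul a Y

theorem pseudoInner_sub_right (X Y Y' : Fin m → ℝ) :
    pseudoInner s X (Y - Y') = pseudoInner s X Y - pseudoInner s X Y' :=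
  (pseudoForm s m X).map_sub Y Y'

theorem pseudoInner_sub_left (X X' Y : Fin m → ℝ) :
    pseudoInner s (X - X') Y = pseudoInner s X Y - pseudoInner s X' Y :=
  (pseudoForm s m).map_sub₂ X X' Y

theorem pseudoInner_zero_right (X : Fin m → ℝ) : pseudoInner s X 0 = 0 :=
  (pseudoForm s m X).map_zero

theorem pseudoInner_zero_left (X : Fin m → ℝ) : pseudoInner s 0 X = 0 :=
  (pseudoForm s m).map_zero₂ X

theorem pseudoInner_sum_right {ι : Type*} (t : Finset ι) (X : Fin m → ℝ) (f : ι → Fin m → ℝ) :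
    pseudoInner s X (∑ i ∈ t, f i) = ∑ i ∈ t, pseudoInner s X (f i) :=
  map_sum (pseudoForm s m X) f t

theorem pseudoInner_sum_left {ι : Type*} (t : Finset ι) (X : Fin m → ℝ) (f : ι → Fin m → ℝ) :
    pseudoInner s (∑ i ∈ t, f i) X = ∑ i ∈ t, pseudoInner s (f i) X :=
  LinearMap.map_sum₂ (pseudoForm s m) t f X

theorem pseudoForm_isSymm : (pseudoForm s m).IsSymm :=
  ⟨fun X Y => pseudoInner_comm X Y⟩

theorem pseudoInner_single (X : Fin m → ℝ) (i : Fin m) :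
    pseudoInner s X (Pi.single i 1) = (if (i : ℕ) < s then (-1 : ℝ) else 1) * X i := by
  rw [pseudoInner, Finset.sum_eq_single i]
  · simp
  · intro j _ hj
    simp [Pi.single_eq_of_ne hj]
  · simp

theorem eq_zero_of_pseudoInner_eq_zero {X : Fin m → ℝ} (h : ∀ Y, pseudoInner s X Y = 0) :
    X = 0 := by
  funext i
  have := h (Pi.single i 1)
  rw [pseudoInner_single] at this
  split_ifs at this <;> simpa using this

theorem pseudoForm_nondegenerate : (pseudoForm s m).Nondegenerate := by
  exact pseudoForm_isSymm.isRefl.nondegenerate_iff_separatingLeft.2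
    fun X h => eq_zero_of_pseudoInner_eq_zero h

/-- Product rule for the scalar product. -/
theorem fderiv_pseudoInner {E : Type*} [NormedAddCommGroup E] [NormedSpace ℝ E]
    {F G : E → Fin m → ℝ} {u : E} (hF : DifferentiableAt ℝ F u) (hG : DifferentiableAt ℝ G u)
    (X : E) :
    fderiv ℝ (fun v => pseudoInner s (F v) (G v)) u X =
      pseudoInner s (fderiv ℝ F u X) (G u) + pseudoInner s (F u) (fderiv ℝ G u X) := by
  have hF' := hasFDerivAt_pi'.1 hF.hasFDerivAt
  have hG' := hasFDerivAt_pi'.1 hG.hasFDerivAt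
  have : HasFDerivAt
      (fun v => ∑ i : Fin m, (if (i : ℕ) < s then (-1 : ℝ) else 1) * F v i * G v i) _ u :=
    HasFDerivAt.fun_sum (u := Finset.univ) fun i _ =>
      ((hF' i).const_mul (if (i : ℕ) < s then (-1 : ℝ) else 1)).mul (hG' i)
  unfold pseudoInner
  rw [HasFDerivAt.fderiv this, ← Finset.sum_add_distrib]
  simp only [sum_apply, add_apply,
    smul_apply, ContinuousLinearMap.comp_apply,
    ContinuousLinearMap.proj_apply, smul_eq_mul]
  exact Finset.sum_congr rfl fun i _ => by ring

theorem ContDiffAt.pseudoInner {E : Type*} [NormedAddCommGroup E] [NormedSpace ℝ E]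
    {F G : E → Fin m → ℝ} {u : E} {k : WithTop ℕ∞} (hF : ContDiffAt ℝ k F u)
    (hG : ContDiffAt ℝ k G u) :
    ContDiffAt ℝ k (fun v => LorentzConformal.pseudoInner s (F v) (G v)) u := by
  unfold LorentzConformal.pseudoInner
  rw [contDiffAt_pi] at hF hG
  exact ContDiffAt.sum fun i _ => (contDiffAt_const.mul (hF i)).mul (hG i)

/-- The normal space of a spacelike immersion into the light cone of `ℝⁿ⁺³₂`. -/
theorem exists_eq_smul_add_smul {n : ℕ} {y e : Fin (n + 3) → ℝ} {d : Fin n → Fin (n + 3) → ℝ}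
    (hy0 : y ≠ 0) (hyy : pseudoInner s y y = 0) (hye : pseudoInner s y e = 0)
    (hee : pseudoInner s e e = -1)
    (hyd : ∀ i, pseudoInner s y (d i) = 0) (hed : ∀ i, pseudoInner s e (d i) = 0)
    (hd : (Matrix.of fun i j => pseudoInner s (d i) (d j)).det ≠ 0)
    {T : Fin (n + 3) → ℝ} (hTy : pseudoInner s T y = 0)
    (hTd : ∀ i, pseudoInner s T (d i) = 0) :
    ∃ a : ℝ, T = a • y - pseudoInner s T e • e := by
  set b : Fin n ⊕ Fin 2 → Fin (n + 3) → ℝ := Sum.elim d ![y, e] with hb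
  have hli : LinearIndependent ℝ b := by
    rw [Fintype.linearIndependent_iff]
    intro w hw
    have hw' : ∑ i, w (Sum.inl i) • d i + (w (Sum.inr 0) • y + w (Sum.inr 1) • e) = 0 := by
      simpa [Fintype.sum_sum_type, hb] using hw
    have h1 : w (Sum.inr 1) = 0 := by
      have := congrArg (pseudoInner s e) hw'
      simp only [pseudoInner_add_right, pseudoInner_sum_right, pseudoInner_smul_right, hed, hee,
        pseudoInner_comm e y, hye, pseudoInner_zero_right] at this
      simpa using this
    have h2 : (fun i => w (Sum.inl i)) = 0 := by
      refine Matrix.eq_zero_of_vecMul_eq_zero hd ?_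
      funext j
      have := congrArg (fun z => pseudoInner s z (d j)) hw'
      simp only [pseudoInner_add_left, pseudoInner_sum_left, pseudoInner_smul_left, hed,
        hyd, pseudoInner_zero_left] at this
      simpa [Matrix.vecMul, dotProduct] using this
    have h3 : w (Sum.inr 0) = 0 := by
      have h2' : ∀ i, w (Sum.inl i) = 0 := fun i => congrFun h2 i
      simpa [h1, h2', hy0] using hw'
    rintro (i | i)
    · exact congrFun h2 i
    · fin_cases i
      · exact h3
      · exact h1
  set S := Submodule.span ℝ (Set.range b) with hS
  have hSd : Module.finrank ℝ S = n + 2 := by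
    rw [hS, finrank_span_eq_card hli]; simp
  have hO : Module.finrank ℝ ((pseudoForm s (n + 3)).orthogonal S) = 1 := by
    have := LinearMap.BilinForm.finrank_orthogonal (B := pseudoForm s (n + 3))
      pseudoForm_nondegenerate S
    rw [this, hSd]; simp
  have hmem : ∀ z, pseudoInner s z y = 0 → pseudoInner s z e = 0 →
      (∀ i, pseudoInner s z (d i) = 0) → z ∈ (pseudoForm s (n + 3)).orthogonal S := by
    intro z h1 h2 h3
    rw [LinearMap.BilinForm.mem_orthogonal_iff]
    intro v hv
    show pseudoInner s v z = 0
    rw [pseudoInner_comm]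
    induction hv using Submodule.span_induction with
    | mem v hv =>
      obtain ⟨i, rfl⟩ := hv
      rcases i with i | i
      · exact h3 i
      · fin_cases i
        · exact h1
        · exact h2
    | zero => exact pseudoInner_zero_right z
    | add v w _ _ h1 h2 => rw [pseudoInner_add_right, h1, h2, add_zero]
    | smul a v _ h => rw [pseudoInner_smul_right, h, mul_zero]
  -- As y is null and orthogonal to e and to every d i, it lies in the orthogonal complement of S,
  -- which is thus the line ℝ y. Adding ⟨T, e⟩ e moves T into that line because ⟨e, e⟩ = -1.
  obtain ⟨a, ha⟩ := (finrank_eq_one_iff_of_nonzero'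
    (⟨y, hmem y hyy hye hyd⟩ : (pseudoForm s (n + 3)).orthogonal S)
    (by simpa using hy0)).1 hO ⟨T + pseudoInner s T e • e, hmem _
      (by rw [pseudoInner_add_left, pseudoInner_smul_left, pseudoInner_comm e, hTy, hye]; ring)
      (by rw [pseudoInner_add_left, pseudoInner_smul_left, hee]; ring)
      (fun i => by rw [pseudoInner_add_left, pseudoInner_smul_left, hTd, hed]; ring)⟩
  refine ⟨a, ?_⟩
  have := congrArg Subtype.val ha
  simp only [SetLike.mk_smul_mk] at this
  rw [this]; abel

end PseudoInner

/-! ## Smoothness of coordinate expressions -/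

section Smoothness

variable {n : ℕ} {W : Type*} [NormedAddCommGroup W] [NormedSpace ℝ W]
  {E : Type*} [NormedAddCommGroup E] [NormedSpace ℝ E]

theorem ContDiffAt.fderiv_apply_const {F : E → W} {u : E} (hF : ContDiffAt ℝ ∞ F u) (Z : E) :
    ContDiffAt ℝ ∞ (fun v => fderiv ℝ F v Z) u :=
  (hF.fderiv_right (m := ∞) (by simp)).clm_apply contDiffAt_const

theorem ContDiffAt.pd {F : Coord n → W} {u : Coord n} (hF : ContDiffAt ℝ ∞ F u) (i : Fin n) :
    ContDiffAt ℝ ∞ (LorentzConformal.pd i F) u :=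
  ContDiffAt.fderiv_apply_const hF _

theorem differentiableAt_of_contDiffAt {F : E → W} {u : E} (hF : ContDiffAt ℝ ∞ F u) :
    DifferentiableAt ℝ F u :=
  hF.differentiableAt (by simp)

theorem contDiffAt_det {ι : Type*} [Fintype ι] [DecidableEq ι] {A : E → Matrix ι ι ℝ} {u : E}
    {k : WithTop ℕ∞} (hA : ∀ i j, ContDiffAt ℝ k (fun v => A v i j) u) :
    ContDiffAt ℝ k (fun v => (A v).det) u := by
  simp only [Matrix.det_apply']
  exact ContDiffAt.sum fun σ _ => contDiffAt_const.mul (contDiffAt_prod fun i _ => hA _ _)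

/-- Cramer's rule: the entries are cofactors divided by the determinant. -/
theorem contDiffAt_matrix_inv {ι : Type*} [Fintype ι] [DecidableEq ι] {A : E → Matrix ι ι ℝ}
    {u : E} {k : WithTop ℕ∞} (hA : ∀ i j, ContDiffAt ℝ k (fun v => A v i j) u)
    (hu : (A u).det ≠ 0) (i j : ι) : ContDiffAt ℝ k (fun v => (A v)⁻¹ i j) u := by
  simp only [Matrix.inv_def, Ring.inverse_eq_inv', Matrix.smul_apply, Matrix.adjugate_apply,
    smul_eq_mul]
  refine ((contDiffAt_det hA).inv hu).mul (contDiffAt_det fun a b => ?_)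
  simp only [Matrix.updateRow_apply]
  split_ifs
  · exact contDiffAt_const
  · exact hA a b

theorem hess_eq {F : E → W} {u : E} (hF : ContDiffAt ℝ ∞ F u) (X Z : E) :
    fderiv ℝ (fun v => fderiv ℝ F v Z) u X = fderiv ℝ (fderiv ℝ F) u X Z := by
  rw [fderiv_clm_apply (differentiableAt_of_contDiffAt (hF.fderiv_right (m := ∞) (by simp)))
    (differentiableAt_const Z)]
  simp

theorem fderiv_fderiv_comm {F : E → W} {u : E} (hF : ContDiffAt ℝ ∞ F u) (X Z : E) :
    fderiv ℝ (fderiv ℝ F) u X Z = fderiv ℝ (fderiv ℝ F) u Z X :=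
  (hF.isSymmSndFDerivAt (by
    rw [minSmoothness_of_isRCLikeNormedField]
    exact WithTop.coe_le_coe.2 le_top)).eq X Z

theorem pd_comm {F : Coord n → W} {u : Coord n} (hF : ContDiffAt ℝ ∞ F u) (i j : Fin n) :
    pd i (pd j F) u = pd j (pd i F) u := by
  unfold pd
  rw [hess_eq hF, hess_eq hF, fderiv_fderiv_comm hF]

theorem pd_congr {F G : Coord n → W} {Ω : Set (Coord n)} (hΩ : IsOpen Ω) {u : Coord n}
    (hu : u ∈ Ω) (h : ∀ v ∈ Ω, F v = G v) (i : Fin n) : pd i F u = pd i G u := by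
  unfold pd
  rw [Filter.EventuallyEq.fderiv_eq (Filter.eventuallyEq_of_mem (hΩ.mem_nhds hu) h)]

theorem pd_pseudoInner {s m : ℕ} {F G : Coord n → Fin m → ℝ} {u : Coord n}
    (hF : ContDiffAt ℝ ∞ F u) (hG : ContDiffAt ℝ ∞ G u) (i : Fin n) :
    pd i (fun v => pseudoInner s (F v) (G v)) u =
      pseudoInner s (pd i F u) (G u) + pseudoInner s (F u) (pd i G u) :=
  fderiv_pseudoInner (differentiableAt_of_contDiffAt hF) (differentiableAt_of_contDiffAt hG) _

theorem pd_mul {f g : Coord n → ℝ} {u : Coord n} (hf : ContDiffAt ℝ ∞ f u)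
    (hg : ContDiffAt ℝ ∞ g u) (i : Fin n) :
    pd i (fun v => f v * g v) u = pd i f u * g u + f u * pd i g u := by
  unfold pd
  rw [fderiv_fun_mul (differentiableAt_of_contDiffAt hf) (differentiableAt_of_contDiffAt hg)]
  simp only [add_apply, smul_apply, smul_eq_mul]
  ring

theorem pd_sum {ι : Type*} (t : Finset ι) {f : ι → Coord n → ℝ} {u : Coord n}
    (hf : ∀ k ∈ t, ContDiffAt ℝ ∞ (f k) u) (i : Fin n) :
    pd i (fun v => ∑ k ∈ t, f k v) u = ∑ k ∈ t, pd i (f k) u := by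
  unfold pd
  rw [fderiv_fun_sum fun k hk => differentiableAt_of_contDiffAt (hf k hk)]
  simp

end Smoothness

/-! ## The Gauss equation for immersions into a pseudo-Euclidean space -/

/-- `y` is a smooth immersion on the open set `Ω`, with nondegenerate induced metric. -/
structure IsNondegenerateOn (s : ℕ) {n m : ℕ} (y : Coord n → Fin m → ℝ) (Ω : Set (Coord n)) :
    Prop where
  isOpen : IsOpen Ω
  contDiffAt : ∀ v ∈ Ω, ContDiffAt ℝ ∞ y v
  det_ne_zero : ∀ v ∈ Ω, (gram (inducedMetric s y) v).det ≠ 0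

section Gauss

variable {s n m : ℕ} {y : Coord n → Fin m → ℝ} {Ω : Set (Coord n)} {u : Coord n}

theorem gram_inducedMetric_apply (v : Coord n) (i j : Fin n) :
    gram (inducedMetric s y) v i j = pseudoInner s (pd i y v) (pd j y v) := rfl

theorem gram_inducedMetric_comm (v : Coord n) (i j : Fin n) :
    gram (inducedMetric s y) v i j = gram (inducedMetric s y) v j i :=
  pseudoInner_comm _ _

theorem gram_inducedMetric_isSymm (v : Coord n) : (gram (inducedMetric s y) v).IsSymm :=
  Matrix.IsSymm.ext fun i j => gram_inducedMetric_comm v j i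

theorem sum_mul_eq_of_det_ne_zero {ι : Type*} [Fintype ι] [DecidableEq ι] {A : Matrix ι ι ℝ}
    (hA : A.det ≠ 0) (hs : A.IsSymm) (c : ι → ℝ) (q : ι) :
    ∑ k, (∑ l, A⁻¹ k l * c l) * A k q = c q := by
  have : ∀ k, A k q = A q k := fun k => hs.apply q k
  have h := congrFun (Matrix.mulVec_mulVec c A A⁻¹) q
  rw [Matrix.mul_nonsing_inv _ (isUnit_iff_ne_zero.2 hA), Matrix.one_mulVec] at h
  rw [← h]
  simp only [Matrix.mulVec, dotProduct, this]
  exact Finset.sum_congr rfl fun k _ => mul_comm _ _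

theorem eq_sum_of_sum_mul_eq {ι : Type*} [Fintype ι] [DecidableEq ι] {A : Matrix ι ι ℝ}
    (hA : A.det ≠ 0) (hs : A.IsSymm) {D c : ι → ℝ} (h : ∀ q, ∑ b, D b * A b q = c q) (b : ι) :
    D b = ∑ q, A⁻¹ b q * c q := by
  have h' : A.mulVec D = c := by
    funext q
    rw [← h q]
    simp only [Matrix.mulVec, dotProduct]
    exact Finset.sum_congr rfl fun k _ => by rw [mul_comm, hs.apply]
  have := congrFun (Matrix.mulVec_mulVec D A⁻¹ A) b
  rw [Matrix.nonsing_inv_mul _ (isUnit_iff_ne_zero.2 hA), Matrix.one_mulVec, h'] at this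
  exact this.symm

/-- The normal part of the second derivative. -/
def normalHess (s : ℕ) (y : Coord n → Fin m → ℝ) (i j : Fin n) (u : Coord n) : Fin m → ℝ :=
  pd i (pd j y) u - ∑ k, christoffel (inducedMetric s y) k i j u • pd k y u

theorem laplacian_eq_sum_normalHess (u : Coord n) :
    laplacian (inducedMetric s y) y u =
      ∑ i, ∑ j, (gram (inducedMetric s y) u)⁻¹ i j • normalHess s y i j u := rfl

namespace IsNondegenerateOn

variable (h : IsNondegenerateOn s y Ω)
include h

theorem contDiffAt_gram (hu : u ∈ Ω) (i j : Fin n) :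
    ContDiffAt ℝ ∞ (fun v => gram (inducedMetric s y) v i j) u :=
  ContDiffAt.pseudoInner (ContDiffAt.pd (h.contDiffAt u hu) i)
    (ContDiffAt.pd (h.contDiffAt u hu) j)

theorem contDiffAt_gram_inv (hu : u ∈ Ω) (i j : Fin n) :
    ContDiffAt ℝ ∞ (fun v => (gram (inducedMetric s y) v)⁻¹ i j) u :=
  contDiffAt_matrix_inv (fun i j => h.contDiffAt_gram hu i j) (h.det_ne_zero u hu) i j

theorem pd_gram (hu : u ∈ Ω) (i j l : Fin n) :
    pd i (fun v => gram (inducedMetric s y) v j l) u =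
      pseudoInner s (pd i (pd j y) u) (pd l y u) + pseudoInner s (pd j y u) (pd i (pd l y) u) :=
  pd_pseudoInner (ContDiffAt.pd (h.contDiffAt u hu) j) (ContDiffAt.pd (h.contDiffAt u hu) l) i

/-- By symmetry of second derivatives, four of the six terms obtained from the derivatives of the
metric cancel and the other two coincide. -/
theorem christoffel_eq (hu : u ∈ Ω) (k i j : Fin n) :
    christoffel (inducedMetric s y) k i j u =
      ∑ l, (gram (inducedMetric s y) u)⁻¹ k l *
        pseudoInner s (pd i (pd j y) u) (pd l y u) := by
  unfold christoffel
  rw [Finset.mul_sum]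
  refine Finset.sum_congr rfl fun l _ => ?_
  have hc := fun a b => pd_comm (h.contDiffAt u hu) a b
  rw [h.pd_gram hu, h.pd_gram hu, h.pd_gram hu, hc j i, hc l i, hc l j,
    pseudoInner_comm (pd j y u), pseudoInner_comm (pd i y u)]
  ring

theorem contDiffAt_christoffel (hu : u ∈ Ω) (k i j : Fin n) :
    ContDiffAt ℝ ∞ (christoffel (inducedMetric s y) k i j) u := by
  refine contDiffAt_const.mul (ContDiffAt.sum fun l _ => (h.contDiffAt_gram_inv hu k l).mul ?_)
  exact ((ContDiffAt.pd (h.contDiffAt_gram hu j l) i).add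
    (ContDiffAt.pd (h.contDiffAt_gram hu i l) j)).sub (ContDiffAt.pd (h.contDiffAt_gram hu i j) l)

theorem sum_christoffel_mul_gram (hu : u ∈ Ω) (i j q : Fin n) :
    ∑ k, christoffel (inducedMetric s y) k i j u * gram (inducedMetric s y) u k q =
      pseudoInner s (pd i (pd j y) u) (pd q y u) := by
  simp only [h.christoffel_eq hu]
  exact sum_mul_eq_of_det_ne_zero (h.det_ne_zero u hu) (gram_inducedMetric_isSymm u) _ q

theorem pseudoInner_normalHess_pd (hu : u ∈ Ω) (i j l : Fin n) :
    pseudoInner s (normalHess s y i j u) (pd l y u) = 0 := by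
  rw [normalHess, pseudoInner_sub_left, pseudoInner_sum_left, ← h.sum_christoffel_mul_gram hu,
    sub_eq_zero]
  simp only [pseudoInner_smul_left, gram_inducedMetric_apply]

theorem pseudoInner_normalHess_pd_pd (hu : u ∈ Ω) (i j k l : Fin n) :
    pseudoInner s (normalHess s y i j u) (pd k (pd l y) u) =
      pseudoInner s (normalHess s y i j u) (normalHess s y k l u) := by
  conv_rhs => rw [normalHess.eq_1 s y k l, pseudoInner_sub_right, pseudoInner_sum_right]
  simp only [pseudoInner_smul_right, h.pseudoInner_normalHess_pd hu, mul_zero,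
    Finset.sum_const_zero, sub_zero]

/-- Differentiate ∑ Γᵇ_jk g_bq = ⟨y_jk, y_q⟩ along i. One half of ∂ᵢ g_bq yields the ΓΓ term; the
other half removes the tangential part of y_jk from ⟨y_jk, y_iq⟩, leaving a product of normal parts.
On the right the third derivative term is symmetric in i and j, so antisymmetrising gives the Gauss
equation. -/
theorem sum_pd_christoffel_mul_gram (hu : u ∈ Ω) (i j k q : Fin n) :
    ∑ b, (pd i (christoffel (inducedMetric s y) b j k) u
        + ∑ a, christoffel (inducedMetric s y) b i a u * christoffel (inducedMetric s y) a j k u)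
        * gram (inducedMetric s y) u b q =
      pseudoInner s (pd i (pd j (pd k y)) u) (pd q y u)
        + pseudoInner s (normalHess s y j k u) (normalHess s y i q u) := by
  have hy := h.contDiffAt u hu
  have h1 := pd_congr h.isOpen hu (fun v hv => h.sum_christoffel_mul_gram hv j k q) i
  rw [pd_pseudoInner (ContDiffAt.pd (ContDiffAt.pd hy k) j) (ContDiffAt.pd hy q),
    pd_sum _ fun b _ => (h.contDiffAt_christoffel hu b j k).mul (h.contDiffAt_gram hu b q)] at h1
  simp only [pd_mul (h.contDiffAt_christoffel hu _ j k) (h.contDiffAt_gram hu _ q),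
    h.pd_gram hu, mul_add, Finset.sum_add_distrib] at h1
  have h2 : ∑ b, (∑ a, christoffel (inducedMetric s y) b i a u *
      christoffel (inducedMetric s y) a j k u) * gram (inducedMetric s y) u b q =
      ∑ a, christoffel (inducedMetric s y) a j k u *
        pseudoInner s (pd i (pd a y) u) (pd q y u) := by
    simp only [← h.sum_christoffel_mul_gram hu i _ q, Finset.sum_mul, Finset.mul_sum]
    rw [Finset.sum_comm]
    exact Finset.sum_congr rfl fun a _ => Finset.sum_congr rfl fun b _ => by ring
  have h3 : pseudoInner s (normalHess s y j k u) (pd i (pd q y) u) =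
      pseudoInner s (pd j (pd k y) u) (pd i (pd q y) u)
        - ∑ a, christoffel (inducedMetric s y) a j k u *
          pseudoInner s (pd a y u) (pd i (pd q y) u) := by
    rw [normalHess, pseudoInner_sub_left, pseudoInner_sum_left]
    simp only [pseudoInner_smul_left]
  rw [← h.pseudoInner_normalHess_pd_pd hu, h3]
  simp only [add_mul, Finset.sum_add_distrib]
  rw [h2]
  linarith

/-- The Gauss equation, contracted once. -/
theorem ricci_eq (hu : u ∈ Ω) (j k : Fin n) :
    ricci (inducedMetric s y) j k u = ∑ i, ∑ q, (gram (inducedMetric s y) u)⁻¹ i q *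
      (pseudoInner s (normalHess s y j k u) (normalHess s y i q u)
        - pseudoInner s (normalHess s y i k u) (normalHess s y j q u)) := by
  unfold ricci
  refine Finset.sum_congr rfl fun i _ => ?_
  -- The upper curvature index is freed as b, lowered to q by the metric, and set back to i at the
  -- end.
  refine eq_sum_of_sum_mul_eq (D := fun b => pd i (christoffel (inducedMetric s y) b j k) u
    - pd j (christoffel (inducedMetric s y) b i k) u
    + ∑ m, (christoffel (inducedMetric s y) b i m u * christoffel (inducedMetric s y) m j k u
      - christoffel (inducedMetric s y) b j m u * christoffel (inducedMetric s y) m i k u))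
    (h.det_ne_zero u hu) (gram_inducedMetric_isSymm u) (fun q => ?_) i
  have h1 := h.sum_pd_christoffel_mul_gram hu i j k q
  have h2 := h.sum_pd_christoffel_mul_gram hu j i k q
  -- The third derivatives of y in h1 and h2 now coincide and cancel in the difference.
  rw [pd_comm (ContDiffAt.pd (h.contDiffAt u hu) k) i j] at h1
  have h3 := congrArg₂ (· - ·) h1 h2
  simp only [← Finset.sum_sub_distrib] at h3
  rw [add_sub_add_left_eq_sub] at h3
  rw [← h3]
  refine Finset.sum_congr rfl fun b _ => ?_
  simp only [Finset.sum_sub_distrib]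
  ring

/-- The Gauss equation, contracted twice. -/
theorem sum_ricci_eq (hu : u ∈ Ω) :
    ∑ j, ∑ k, (gram (inducedMetric s y) u)⁻¹ j k * ricci (inducedMetric s y) j k u =
      pseudoInner s (laplacian (inducedMetric s y) y u) (laplacian (inducedMetric s y) y u)
      - ∑ j, ∑ k, ∑ i, ∑ q, (gram (inducedMetric s y) u)⁻¹ j k *
          (gram (inducedMetric s y) u)⁻¹ i q *
          pseudoInner s (normalHess s y i k u) (normalHess s y j q u) := by
  simp only [h.ricci_eq hu, laplacian_eq_sum_normalHess, pseudoInner_sum_left,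
    pseudoInner_sum_right, pseudoInner_smul_left, pseudoInner_smul_right,
    ← Finset.sum_sub_distrib, Finset.mul_sum]
  refine Finset.sum_congr rfl fun j _ => Finset.sum_congr rfl fun k _ =>
    Finset.sum_congr rfl fun i _ => Finset.sum_congr rfl fun q _ => ?_
  rw [pseudoInner_comm (normalHess s y i q u) (normalHess s y j k u)]
  ring

theorem contDiffAt_laplacian (hu : u ∈ Ω) :
    ContDiffAt ℝ ∞ (laplacian (inducedMetric s y) y) u := by
  refine ContDiffAt.sum fun i _ => ContDiffAt.sum fun j _ => (h.contDiffAt_gram_inv hu i j).smul ?_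
  exact (ContDiffAt.pd (ContDiffAt.pd (h.contDiffAt u hu) j) i).sub (ContDiffAt.sum fun k _ =>
    (h.contDiffAt_christoffel hu k i j).smul (ContDiffAt.pd (h.contDiffAt u hu) k))

theorem contDiffAt_normalizedScalarCurvature (hu : u ∈ Ω) :
    ContDiffAt ℝ ∞ (normalizedScalarCurvature (inducedMetric s y)) u := by
  refine ContDiffAt.div_const (ContDiffAt.sum fun j _ => ContDiffAt.sum fun k _ =>
    (h.contDiffAt_gram_inv hu j k).mul (ContDiffAt.sum fun i _ => ?_)) _
  have hc := fun a b c => h.contDiffAt_christoffel hu a b c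
  exact ((ContDiffAt.pd (hc _ _ _) _).sub (ContDiffAt.pd (hc _ _ _) _)).add
    (ContDiffAt.sum fun m _ => ((hc _ _ _).mul (hc _ _ _)).sub ((hc _ _ _).mul (hc _ _ _)))

end IsNondegenerateOn

end Gauss

/-! ## Immersions into the light cone -/

section LightCone

/-- This is the contraction in the Gauss equation. As a trace, it collapses by G⁻¹ G = 1 whenever A
or B is the metric itself. -/
theorem sum_mul_mul_eq_trace {ι : Type*} [Fintype ι] (G A B : Matrix ι ι ℝ) :
    ∑ j, ∑ k, ∑ i, ∑ q, G j k * G i q * (A i k * B j q) =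
      (G * A.transpose * (G * B.transpose)).trace := by
  simp only [Matrix.trace, Matrix.diag_apply, Matrix.mul_apply, Matrix.transpose_apply]
  refine Finset.sum_congr rfl fun j _ => ?_
  simp only [Finset.sum_mul, Finset.mul_sum]
  rw [Finset.sum_comm]
  refine Finset.sum_congr rfl fun i _ => ?_
  rw [Finset.sum_comm]
  exact Finset.sum_congr rfl fun q _ => Finset.sum_congr rfl fun k _ => by ring

theorem sum_mul_eq_trace {ι : Type*} [Fintype ι] (G B : Matrix ι ι ℝ) :
    ∑ i, ∑ j, G i j * B i j = (G * B.transpose).trace := by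
  simp only [Matrix.trace, Matrix.diag_apply, Matrix.mul_apply, Matrix.transpose_apply]

open scoped MatrixOrder Matrix.Norms.L2Operator in
-- Write G = BᵀB and let N = B T Bᵀ, which is symmetric. By cyclicity the trace is tr(NᵀN), which
-- vanishes only if N = 0, that is T = 0. In the application G is the inverse of I, so this is where
-- spacelikeness makes the conformal factor positive.
theorem trace_mul_mul_mul_pos {ι : Type*} [Fintype ι] [DecidableEq ι] {G T : Matrix ι ι ℝ}
    (hG : G.PosDef) (hT : T.IsSymm) (h0 : T ≠ 0) : 0 < (G * T * (G * T)).trace := by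
  obtain ⟨B, hB⟩ := CStarAlgebra.nonneg_iff_eq_star_mul_self.mp hG.posSemidef.nonneg
  have hB' : G = B.transpose * B := by
    rw [hB, Matrix.star_eq_conjTranspose, Matrix.conjTranspose_eq_transpose_of_trivial]
  have hBd : IsUnit B.det := by
    have := hG.isUnit
    rw [Matrix.isUnit_iff_isUnit_det, hB', Matrix.det_mul] at this
    exact isUnit_of_mul_isUnit_right this
  have hBd' : IsUnit B.transpose.det := by rwa [Matrix.det_transpose]
  set N := B * T * B.transpose with hN
  have hNs : N.conjTranspose = N := by
    rw [Matrix.conjTranspose_eq_transpose_of_trivial, hN, Matrix.transpose_mul,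
      Matrix.transpose_mul, Matrix.transpose_transpose, hT.eq, Matrix.mul_assoc]
  have htr : (G * T * (G * T)).trace = (N.conjTranspose * N).trace := by
    rw [hNs, hB', hN]
    have : B.transpose * B * T * (B.transpose * B * T) =
        B.transpose * (B * T * B.transpose * (B * T)) := by simp only [Matrix.mul_assoc]
    rw [this, Matrix.trace_mul_comm]
    simp only [Matrix.mul_assoc]
  rw [htr]
  refine lt_of_le_of_ne (Matrix.posSemidef_conjTranspose_mul_self N).trace_nonneg fun h => ?_
  have hN0 := Matrix.trace_conjTranspose_mul_self_eq_zero_iff.1 h.symm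
  apply h0
  have : B⁻¹ * N * B.transpose⁻¹ = T := by
    rw [hN, ← Matrix.mul_assoc, ← Matrix.mul_assoc, Matrix.nonsing_inv_mul _ hBd, Matrix.one_mul,
      Matrix.mul_assoc, Matrix.mul_nonsing_inv _ hBd', Matrix.mul_one]
  rw [← this, hN0, Matrix.mul_zero, Matrix.zero_mul]

variable {s n m : ℕ}

/-- The component `-⟨D²y(X, Z), e⟩` of the second derivative along a unit timelike normal `e`. -/
def normalSecond (s : ℕ) (y : Coord n → Fin m → ℝ) (e : Fin m → ℝ) (u X Z : Coord n) : ℝ :=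
  -pseudoInner s (hess y u X Z) e

/-- The mean value of the eigenvalues of `normalSecond`. -/
def meanCurvature (s : ℕ) (y : Coord n → Fin m → ℝ) (e : Fin m → ℝ) (u : Coord n) : ℝ :=
  (1 / n) * ∑ i, ∑ j, (gram (inducedMetric s y) u)⁻¹ i j *
    gram (fun v => normalSecond s y e v) u i j

/-- The traceless part of `normalSecond`. -/
def tracelessSecond (s : ℕ) (y : Coord n → Fin m → ℝ) (e : Fin m → ℝ) (u X Z : Coord n) : ℝ :=
  normalSecond s y e u X Z - meanCurvature s y e u * inducedMetric s y u X Z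

/-- The factor of the conformal metric of an immersion into the light cone. -/
def coneFactor (s : ℕ) (y : Coord n → Fin m → ℝ) (u : Coord n) : ℝ :=
  -(pseudoInner s (laplacian (inducedMetric s y) y u) (laplacian (inducedMetric s y) y u)
    - (n : ℝ) ^ 2 * normalizedScalarCurvature (inducedMetric s y) u)

/-- `e` is a unit timelike vector orthogonal to `y` and `dy` at `u`. -/
structure IsConeNormal (s : ℕ) (y : Coord n → Fin m → ℝ) (u : Coord n) (e : Fin m → ℝ) :
    Prop where
  orthogonal : pseudoInner s (y u) e = 0
  orthogonal_fderiv : ∀ X, pseudoInner s e (fderiv ℝ y u X) = 0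
  unit : pseudoInner s e e = -1

/-- `y` is an immersion into the light cone with nondegenerate induced metric. -/
structure IsConeImmersion (s : ℕ) (y : Coord n → Fin m → ℝ) (Ω : Set (Coord n)) : Prop
    extends IsNondegenerateOn s y Ω where
  ne_zero : ∀ v ∈ Ω, y v ≠ 0
  null : ∀ v ∈ Ω, pseudoInner s (y v) (y v) = 0

theorem sum_smul_single (X : Coord n) :
    X = ∑ i, X i • (EuclideanSpace.single i 1 : Coord n) := by
  ext j
  simp [Pi.single_apply]

theorem eq_zero_of_single {β : Coord n → Coord n → ℝ} (B : Coord n →ₗ[ℝ] Coord n →ₗ[ℝ] ℝ)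
    (hB : ∀ X Z, B X Z = β X Z)
    (h : ∀ i j, β (EuclideanSpace.single i 1) (EuclideanSpace.single j 1) = 0)
    (X Z : Coord n) : β X Z = 0 := by
  rw [← hB, sum_smul_single X, sum_smul_single Z]
  simp [hB, h]

theorem hess_eq_fderiv_fderiv {F : Coord n → Fin m → ℝ} {u : Coord n} (hF : ContDiffAt ℝ ∞ F u)
    (X Z : Coord n) : hess F u X Z = fderiv ℝ (fderiv ℝ F) u X Z :=
  hess_eq hF X Z

theorem exists_linear_normalSecond {y : Coord n → Fin m → ℝ} {u : Coord n}
    (hy : ContDiffAt ℝ ∞ y u) (e : Fin m → ℝ) :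
    ∃ B : Coord n →ₗ[ℝ] Coord n →ₗ[ℝ] ℝ, ∀ X Z, B X Z = normalSecond s y e u X Z := by
  refine ⟨LinearMap.mk₂ ℝ (normalSecond s y e u) ?_ ?_ ?_ ?_, fun X Z => rfl⟩ <;> intros <;>
    simp only [normalSecond, hess_eq_fderiv_fderiv hy, map_add, map_smul, add_apply,
      smul_apply, pseudoInner_add_left, pseudoInner_smul_left, smul_eq_mul, neg_add, mul_neg]

theorem exists_linear_inducedMetric {y : Coord n → Fin m → ℝ} {u : Coord n} :
    ∃ B : Coord n →ₗ[ℝ] Coord n →ₗ[ℝ] ℝ, ∀ X Z, B X Z = inducedMetric s y u X Z := by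
  refine ⟨LinearMap.mk₂ ℝ (inducedMetric s y u) ?_ ?_ ?_ ?_, fun X Z => rfl⟩ <;> intros <;>
    simp only [inducedMetric, map_add, map_smul, pseudoInner_add_left, pseudoInner_smul_left,
      pseudoInner_add_right, pseudoInner_smul_right, smul_eq_mul]

theorem tracelessSecond_eq_zero {y : Coord n → Fin m → ℝ} {u : Coord n}
    (hy : ContDiffAt ℝ ∞ y u) {e : Fin m → ℝ} (h : gram (tracelessSecond s y e) u = 0)
    (X Z : Coord n) : tracelessSecond s y e u X Z = 0 := by
  obtain ⟨B, hB⟩ := exists_linear_normalSecond (s := s) hy e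
  obtain ⟨C, hC⟩ := exists_linear_inducedMetric (s := s) (y := y) (u := u)
  refine eq_zero_of_single (B - meanCurvature s y e u • C) (fun X Z => ?_)
    (fun i j => congrFun (congrFun h i) j) X Z
  simp [hB, hC, tracelessSecond]

theorem gram_tracelessSecond_isSymm {y : Coord n → Fin m → ℝ} {u : Coord n}
    (hy : ContDiffAt ℝ ∞ y u) (e : Fin m → ℝ) : (gram (tracelessSecond s y e) u).IsSymm := by
  refine Matrix.IsSymm.ext fun i j => ?_
  simp only [gram, Matrix.of_apply, tracelessSecond, normalSecond, hess_eq_fderiv_fderiv hy,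
    inducedMetric]
  rw [fderiv_fderiv_comm hy, pseudoInner_comm (fderiv ℝ y u _)]

theorem IsNondegenerateOn.sum_inv_mul_gram {y : Coord n → Fin m → ℝ} {Ω : Set (Coord n)}
    (h : IsNondegenerateOn s y Ω) {u : Coord n} (hu : u ∈ Ω) :
    ∑ i, ∑ j, (gram (inducedMetric s y) u)⁻¹ i j * gram (inducedMetric s y) u i j = n := by
  rw [sum_mul_eq_trace, (gram_inducedMetric_isSymm u).eq,
    Matrix.nonsing_inv_mul _ (isUnit_iff_ne_zero.2 (h.det_ne_zero u hu))]
  simp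

section

variable {y : Coord n → Fin m → ℝ} {u : Coord n} {e : Fin m → ℝ}

theorem IsConeNormal.pseudoInner_normalHess (he : IsConeNormal s y u e)
    (i j : Fin n) :
    pseudoInner s (normalHess s y i j u) e = -gram (fun v => normalSecond s y e v) u i j := by
  rw [normalHess, pseudoInner_sub_left, pseudoInner_sum_left]
  have h2 : ∀ k, pseudoInner s (pd k y u) e = 0 := fun k => by
    rw [pseudoInner_comm]; exact he.orthogonal_fderiv _
  simp only [pseudoInner_smul_left, h2, mul_zero, Finset.sum_const_zero, sub_zero]
  exact (neg_neg _).symm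

theorem IsConeNormal.pseudoInner_laplacian (hn : n ≠ 0) (he : IsConeNormal s y u e) :
    pseudoInner s (laplacian (inducedMetric s y) y u) e = -(n * meanCurvature s y e u) := by
  have hn' : (n : ℝ) ≠ 0 := Nat.cast_ne_zero.2 hn
  rw [laplacian_eq_sum_normalHess, meanCurvature, ← mul_assoc, mul_one_div_cancel hn', one_mul]
  simp only [pseudoInner_sum_left, pseudoInner_smul_left, he.pseudoInner_normalHess,
    mul_neg, Finset.sum_neg_distrib]

end

namespace IsConeImmersion

variable {y : Coord n → Fin m → ℝ} {Ω : Set (Coord n)} {u : Coord n} {e : Fin m → ℝ}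
  (h : IsConeImmersion s y Ω)
include h

theorem pseudoInner_fderiv (hu : u ∈ Ω) (X : Coord n) :
    pseudoInner s (y u) (fderiv ℝ y u X) = 0 := by
  have hd := differentiableAt_of_contDiffAt (h.contDiffAt u hu)
  have h1 : (fun v => pseudoInner s (y v) (y v)) =ᶠ[nhds u] fun _ => 0 :=
    Filter.eventuallyEq_of_mem (h.isOpen.mem_nhds hu) h.null
  have h2 := fderiv_pseudoInner (s := s) hd hd X
  rw [h1.fderiv_eq, pseudoInner_comm (fderiv ℝ y u X)] at h2
  simp only [fderiv_fun_const, Pi.zero_apply, zero_apply] at h2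
  linarith

/-- Differentiate ⟨y, dy(Z)⟩ = 0 along X. Adding a multiple of y to a normal vector thus shifts the
second form by a multiple of the metric. -/
theorem pseudoInner_hess (hu : u ∈ Ω) (X Z : Coord n) :
    pseudoInner s (hess y u X Z) (y u) = -inducedMetric s y u X Z := by
  have hd := differentiableAt_of_contDiffAt (h.contDiffAt u hu)
  have hd' := differentiableAt_of_contDiffAt
    (ContDiffAt.fderiv_apply_const (h.contDiffAt u hu) Z)
  have h1 : (fun v => pseudoInner s (y v) (fderiv ℝ y v Z)) =ᶠ[nhds u] fun _ => 0 :=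
    Filter.eventuallyEq_of_mem (h.isOpen.mem_nhds hu) fun v hv => h.pseudoInner_fderiv hv Z
  have h2 := fderiv_pseudoInner (s := s) hd hd' X
  rw [h1.fderiv_eq] at h2
  simp only [fderiv_fun_const, Pi.zero_apply, zero_apply] at h2
  rw [pseudoInner_comm, hess, inducedMetric]
  linarith

theorem pseudoInner_normalHess_self (hu : u ∈ Ω) (i j : Fin n) :
    pseudoInner s (normalHess s y i j u) (y u) = -gram (inducedMetric s y) u i j := by
  rw [normalHess, pseudoInner_sub_left, pseudoInner_sum_left]
  have := h.pseudoInner_hess hu (EuclideanSpace.single i 1) (EuclideanSpace.single j 1)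
  have h2 : ∀ k, pseudoInner s (pd k y u) (y u) = 0 := fun k => by
    rw [pseudoInner_comm]; exact h.pseudoInner_fderiv hu _
  simp only [pseudoInner_smul_left, h2, mul_zero, Finset.sum_const_zero, sub_zero]
  exact this

theorem pseudoInner_laplacian_self (hu : u ∈ Ω) :
    pseudoInner s (laplacian (inducedMetric s y) y u) (y u) = -n := by
  rw [laplacian_eq_sum_normalHess]
  simp only [pseudoInner_sum_left, pseudoInner_smul_left, h.pseudoInner_normalHess_self hu,
    mul_neg, Finset.sum_neg_distrib, h.sum_inv_mul_gram hu]

theorem pseudoInner_laplacian_pd (hu : u ∈ Ω) (i : Fin n) :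
    pseudoInner s (laplacian (inducedMetric s y) y u) (pd i y u) = 0 := by
  rw [laplacian_eq_sum_normalHess]
  simp only [pseudoInner_sum_left, pseudoInner_smul_left, h.pseudoInner_normalHess_pd hu,
    mul_zero, Finset.sum_const_zero]

theorem contDiffAt_coneFactor (hu : u ∈ Ω) : ContDiffAt ℝ ∞ (coneFactor s y) u :=
  ((ContDiffAt.pseudoInner (h.contDiffAt_laplacian hu) (h.contDiffAt_laplacian hu)).sub
    (contDiffAt_const.mul (h.contDiffAt_normalizedScalarCurvature hu))).neg

end IsConeImmersion

/-! ### The Gauss equation in codimension three and the conformal factor -/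

section Codimension

variable {y : Coord n → Fin (n + 3) → ℝ} {Ω : Set (Coord n)} {u : Coord n}
  {e : Fin (n + 3) → ℝ}

theorem IsConeImmersion.exists_eq (h : IsConeImmersion s y Ω) (hu : u ∈ Ω)
    (he : IsConeNormal s y u e) {T : Fin (n + 3) → ℝ} (hT : pseudoInner s T (y u) = 0)
    (hTd : ∀ i, pseudoInner s T (pd i y u) = 0) :
    ∃ a : ℝ, T = a • y u - pseudoInner s T e • e :=
  exists_eq_smul_add_smul (h.ne_zero u hu) (h.null u hu) he.orthogonal he.unit
    (fun _ => h.pseudoInner_fderiv hu _) (fun _ => he.orthogonal_fderiv _) (h.det_ne_zero u hu)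
    hT hTd

/-- Since ⟨Δy, y⟩ = -n and Δy is orthogonal to dy, subtracting (1/n) g Δy from the normal Hessian
leaves a vector orthogonal to y and dy, hence a multiple of y plus T e. The unknown multiple enters
the products only through ⟨y, Δy⟩, and is absorbed into the product of Δy with the normal Hessian,
whose trace is known. -/
theorem IsConeImmersion.pseudoInner_normalHess_normalHess (h : IsConeImmersion s y Ω)
    (hu : u ∈ Ω) (hn : n ≠ 0) (he : IsConeNormal s y u e) (i k j q : Fin n) :
    pseudoInner s (normalHess s y i k u) (normalHess s y j q u) =
      -(gram (tracelessSecond s y e) u i k * gram (tracelessSecond s y e) u j q)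
      + (1 / n) * (gram (inducedMetric s y) u i k *
          pseudoInner s (laplacian (inducedMetric s y) y u) (normalHess s y j q u))
      + (1 / n) * (pseudoInner s (laplacian (inducedMetric s y) y u) (normalHess s y i k u) *
          gram (inducedMetric s y) u j q)
      - (1 / n) ^ 2 * pseudoInner s (laplacian (inducedMetric s y) y u)
          (laplacian (inducedMetric s y) y u) *
          (gram (inducedMetric s y) u i k * gram (inducedMetric s y) u j q) := by
  have hn' : (n : ℝ) ≠ 0 := Nat.cast_ne_zero.2 hn
  set D := laplacian (inducedMetric s y) y u with hD
  have hT : ∀ i k, ∃ a : ℝ, normalHess s y i k u =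
      a • y u + gram (tracelessSecond s y e) u i k • e
        + ((1 / n) * gram (inducedMetric s y) u i k) • D := by
    intro i k
    obtain ⟨a, ha⟩ := h.exists_eq hu he
      (T := normalHess s y i k u - ((1 / n) * gram (inducedMetric s y) u i k) • D)
      (by
        rw [pseudoInner_sub_left, pseudoInner_smul_left, h.pseudoInner_normalHess_self hu,
          h.pseudoInner_laplacian_self hu]
        field_simp
        ring)
      (fun l => by
        rw [pseudoInner_sub_left, pseudoInner_smul_left, h.pseudoInner_normalHess_pd hu,
          h.pseudoInner_laplacian_pd hu, mul_zero, sub_zero])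
    refine ⟨a, ?_⟩
    have he1 : pseudoInner s (normalHess s y i k u -
        ((1 / n) * gram (inducedMetric s y) u i k) • D) e =
        -gram (tracelessSecond s y e) u i k := by
      rw [pseudoInner_sub_left, pseudoInner_smul_left, he.pseudoInner_normalHess,
        he.pseudoInner_laplacian hn]
      simp only [gram, Matrix.of_apply, tracelessSecond]
      field_simp
      ring
    rw [he1, sub_eq_iff_eq_add] at ha
    rw [ha, neg_smul, sub_neg_eq_add]
  obtain ⟨a, ha⟩ := hT i k
  obtain ⟨b, hb⟩ := hT j q
  have hyy := h.null u hu
  have hye := he.orthogonal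
  have hey := (pseudoInner_comm (s := s) e (y u)).trans hye
  have hee := he.unit
  rw [ha, hb]
  simp only [pseudoInner_add_left, pseudoInner_add_right, pseudoInner_smul_left,
    pseudoInner_smul_right, hyy, hye, hey, hee, pseudoInner_comm (y u) D, pseudoInner_comm e D]
  ring

/-- The factor of the conformal metric is a multiple of the squared norm of the traceless part of
the second fundamental form. -/
theorem IsConeImmersion.coneFactor_eq (h : IsConeImmersion s y Ω)
    (hu : u ∈ Ω) (hn : 2 ≤ n) (he : IsConeNormal s y u e) :
    coneFactor s y u = n / (n - 1) *
      ((gram (inducedMetric s y) u)⁻¹ * gram (tracelessSecond s y e) u *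
        ((gram (inducedMetric s y) u)⁻¹ * gram (tracelessSecond s y e) u)).trace := by
  have hn0 : n ≠ 0 := by omega
  have hn' : (n : ℝ) ≠ 0 := Nat.cast_ne_zero.2 hn0
  have hn1 : (n : ℝ) - 1 ≠ 0 := by
    have : (2 : ℝ) ≤ n := by exact_mod_cast hn
    linarith
  have hy := h.contDiffAt u hu
  set D := laplacian (inducedMetric s y) y u with hD
  set G := gram (inducedMetric s y) u with hG
  set T := gram (tracelessSecond s y e) u with hTdef
  have hTs : T.transpose = T := (gram_tracelessSecond_isSymm hy e).eq
  have hGs : G.transpose = G := (gram_inducedMetric_isSymm u).eq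
  have hGG : G⁻¹ * G = 1 :=
    Matrix.nonsing_inv_mul _ (isUnit_iff_ne_zero.2 (h.det_ne_zero u hu))
  set B : Matrix (Fin n) (Fin n) ℝ :=
    Matrix.of fun i j => pseudoInner s D (normalHess s y i j u) with hB
  have hDD : (G⁻¹ * B.transpose).trace = pseudoInner s D D := by
    rw [← sum_mul_eq_trace]
    conv_rhs => rw [hD, laplacian_eq_sum_normalHess, ← laplacian_eq_sum_normalHess, ← hD]
    -- Only the second of the two equal factors is expanded.
    conv_rhs => arg 3; rw [hD, laplacian_eq_sum_normalHess]
    simp only [pseudoInner_sum_right, pseudoInner_smul_right]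
    rfl
  have hC : ∑ j, ∑ k, ∑ i, ∑ q, G⁻¹ j k * G⁻¹ i q *
      pseudoInner s (normalHess s y i k u) (normalHess s y j q u) =
      -(G⁻¹ * T * (G⁻¹ * T)).trace + (1 / n) * pseudoInner s D D := by
    have h1 := sum_mul_mul_eq_trace G⁻¹ T T
    have h2 := sum_mul_mul_eq_trace G⁻¹ G B
    have h3 := sum_mul_mul_eq_trace G⁻¹ B G
    have h4 := sum_mul_mul_eq_trace G⁻¹ G G
    rw [hTs] at h1
    rw [hGs, hGG, Matrix.one_mul, hDD] at h2
    rw [hGs, hGG, Matrix.mul_one, hDD] at h3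
    rw [hGs, hGG, Matrix.mul_one, Matrix.trace_one, Fintype.card_fin] at h4
    have h5 : ∀ i k j q, pseudoInner s (normalHess s y i k u) (normalHess s y j q u) =
        -(T i k * T j q) + (1 / n) * (G i k * B j q) + (1 / n) * (B i k * G j q)
        - (1 / n) ^ 2 * pseudoInner s D D * (G i k * G j q) :=
      h.pseudoInner_normalHess_normalHess hu hn0 he
    have h6 : ∀ i k j q, G⁻¹ j k * G⁻¹ i q *
        pseudoInner s (normalHess s y i k u) (normalHess s y j q u) =
        -(G⁻¹ j k * G⁻¹ i q * (T i k * T j q))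
        + (1 / n) * (G⁻¹ j k * G⁻¹ i q * (G i k * B j q))
        + (1 / n) * (G⁻¹ j k * G⁻¹ i q * (B i k * G j q))
        - (1 / n) ^ 2 * pseudoInner s D D * (G⁻¹ j k * G⁻¹ i q * (G i k * G j q)) := by
      intro i k j q
      rw [h5]
      ring
    simp only [h6, Finset.sum_add_distrib, Finset.sum_sub_distrib, Finset.sum_neg_distrib,
      ← Finset.mul_sum]
    rw [h1, h2, h3, h4]
    field_simp
    ring
  -- The scalar curvature is (1 - 1/n)⟨Δy, Δy⟩ + |T|², so n²κ = ⟨Δy, Δy⟩ + n/(n-1) |T|². The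
  -- coefficient n² is the one for which ⟨Δy, Δy⟩ cancels.
  rw [coneFactor, normalizedScalarCurvature, h.sum_ricci_eq hu, ← hG, hC, ← hD]
  field_simp
  ring

end Codimension

end LightCone

/-! ## The conformal second fundamental form -/

section Smul

variable {n : ℕ} {W : Type*} [NormedAddCommGroup W] [NormedSpace ℝ W]
  {μ : Coord n → ℝ} {y : Coord n → W} {u : Coord n}

theorem fderiv_smul_apply (hμ : DifferentiableAt ℝ μ u) (hy : DifferentiableAt ℝ y u)
    (X : Coord n) :
    fderiv ℝ (fun v => μ v • y v) u X = μ u • fderiv ℝ y u X + fderiv ℝ μ u X • y u := by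
  rw [fderiv_fun_smul hμ hy]
  simp

theorem eventually_differentiableAt {E : Type*} [NormedAddCommGroup E] [NormedSpace ℝ E]
    {F : E → W} {u : E} (hF : ContDiffAt ℝ ∞ F u) : ∀ᶠ v in nhds u, DifferentiableAt ℝ F v :=
  ((hF.of_le (m := 1) (WithTop.coe_le_coe.2 le_top)).eventually (by simp)).mono
    fun _ hv => hv.differentiableAt (by simp)

theorem hess_smul (hμ : ContDiffAt ℝ ∞ μ u) (hy : ContDiffAt ℝ ∞ y u) (X Z : Coord n) :
    hess (fun v => μ v • y v) u X Z =
      μ u • hess y u X Z + fderiv ℝ μ u X • fderiv ℝ y u Z + fderiv ℝ μ u Z • fderiv ℝ y u X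
        + hess μ u X Z • y u := by
  have h1 : (fun v => fderiv ℝ (fun v => μ v • y v) v Z) =ᶠ[nhds u]
      fun v => μ v • fderiv ℝ y v Z + fderiv ℝ μ v Z • y v := by
    filter_upwards [eventually_differentiableAt hμ, eventually_differentiableAt hy]
      with v h1 h2 using fderiv_smul_apply h1 h2 Z
  have hμ0 := differentiableAt_of_contDiffAt hμ
  have hy0 := differentiableAt_of_contDiffAt hy
  have hμ1 := differentiableAt_of_contDiffAt (ContDiffAt.fderiv_apply_const hμ Z)
  have hy1 := differentiableAt_of_contDiffAt (ContDiffAt.fderiv_apply_const hy Z)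
  rw [hess, h1.fderiv_eq, fderiv_fun_add (hμ0.fun_smul hy1) (hμ1.fun_smul hy0), add_apply,
    fderiv_smul_apply hμ0 hy1, fderiv_smul_apply hμ1 hy0]
  simp only [hess]
  abel

end Smul

/-! ### The Laplace operator of a rescaled metric -/

section Laplacian

variable {n : ℕ} {s m : ℕ} {y : Coord n → Fin m → ℝ} {u : Coord n} {f : Coord n → ℝ}

theorem gram_mul (g : Coord n → Coord n → Coord n → ℝ) (u : Coord n) :
    gram (fun v X Z => f v * g v X Z) u = f u • gram g u := by
  ext i j
  simp [gram]

/-- Against a vector orthogonal to the first derivatives of F the Christoffel terms drop out, so the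
connection of the rescaled metric need not be computed. -/
theorem pseudoInner_laplacian_mul (hf : f u ≠ 0) (hd : (gram (inducedMetric s y) u).det ≠ 0)
    (F : Coord n → Fin m → ℝ) (w : Fin m → ℝ) (hw : ∀ k, pseudoInner s w (pd k F u) = 0) :
    pseudoInner s w (laplacian (fun v X Z => f v * inducedMetric s y v X Z) F u) =
      (f u)⁻¹ * ∑ i, ∑ j, (gram (inducedMetric s y) u)⁻¹ i j *
        pseudoInner s w (hess F u (EuclideanSpace.single i 1) (EuclideanSpace.single j 1)) := by
  have hinv : (gram (fun v X Z => f v * inducedMetric s y v X Z) u)⁻¹ =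
      (f u)⁻¹ • (gram (inducedMetric s y) u)⁻¹ := by
    rw [gram_mul]
    refine Matrix.inv_eq_left_inv ?_
    rw [Matrix.smul_mul, Matrix.mul_smul, smul_smul, inv_mul_cancel₀ hf, one_smul,
      Matrix.nonsing_inv_mul _ (isUnit_iff_ne_zero.2 hd)]
  rw [laplacian, hinv]
  simp only [pseudoInner_sum_right, pseudoInner_smul_right, pseudoInner_sub_right, hw, mul_zero,
    Finset.sum_const_zero, sub_zero, Matrix.smul_apply, smul_eq_mul, Finset.mul_sum, mul_assoc]
  rfl

end Laplacian

/-! ### The conformal normal and the form B in terms of y -/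

section ConformalSecondForm

variable {c : SignType} {n : ℕ} {M : Type*} [TopologicalSpace M] [ChartedSpace (Coord n) M]
  {x : M → Ambient c n} {p : M} {Ω : Set (Coord n)} {e : Ambient c n}

theorem conformalFactor_eq_coneFactor : conformalFactor c x p = coneFactor 2 (lift c x p) := rfl

variable (h : IsConeImmersion 2 (lift c x p) Ω) (hu : basePoint n p ∈ Ω)
  (hf : 0 < conformalFactor c x p (basePoint n p))
include h hu hf

theorem contDiffAt_sqrt_conformalFactor :
    ContDiffAt ℝ ∞ (fun u => Real.sqrt (conformalFactor c x p u)) (basePoint n p) :=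
  (h.contDiffAt_coneFactor hu).sqrt hf.ne'

theorem fderiv_conformalPosition (X : Coord n) :
    fderiv ℝ (conformalPosition c x p) (basePoint n p) X =
      Real.sqrt (conformalFactor c x p (basePoint n p)) •
        fderiv ℝ (lift c x p) (basePoint n p) X +
      fderiv ℝ (fun u => Real.sqrt (conformalFactor c x p u)) (basePoint n p) X •
        lift c x p (basePoint n p) :=
  fderiv_smul_apply (differentiableAt_of_contDiffAt (contDiffAt_sqrt_conformalFactor h hu hf))
    (differentiableAt_of_contDiffAt (h.contDiffAt _ hu)) X

/-- In the Leibniz rule for √f y, each term containing a derivative of √f is a multiple of y or of a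
value of dy, and w annihilates both. -/
theorem pseudoInner_hess_conformalPosition {w : Fin (n + 3) → ℝ}
    (hw : pseudoInner 2 w (lift c x p (basePoint n p)) = 0)
    (hwd : ∀ X, pseudoInner 2 w (fderiv ℝ (lift c x p) (basePoint n p) X) = 0) (X Z : Coord n) :
    pseudoInner 2 w (hess (conformalPosition c x p) (basePoint n p) X Z) =
      Real.sqrt (conformalFactor c x p (basePoint n p)) *
        pseudoInner 2 w (hess (lift c x p) (basePoint n p) X Z) := by
  have := hess_smul (contDiffAt_sqrt_conformalFactor h hu hf) (h.contDiffAt _ hu) X Z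
  unfold conformalPosition
  rw [this]
  simp only [pseudoInner_add_right, pseudoInner_smul_right, hw, hwd]
  ring

/-- For w orthogonal to Y, orthogonality to N means orthogonality to ΔY. As w is also orthogonal to
dY, this says up to nonzero factors that ⟨w, D²y⟩ has trace zero. -/
theorem pseudoInner_conformalN {w : Fin (n + 3) → ℝ} (hn : n ≠ 0)
    (hw : pseudoInner 2 w (lift c x p (basePoint n p)) = 0)
    (hwd : ∀ X, pseudoInner 2 w (fderiv ℝ (lift c x p) (basePoint n p) X) = 0) :
    pseudoInner 2 w (conformalN c x p (basePoint n p)) = 0 ↔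
      ∑ i, ∑ j, (gram (inducedMetric 2 (lift c x p)) (basePoint n p))⁻¹ i j *
        pseudoInner 2 w (hess (lift c x p) (basePoint n p) (EuclideanSpace.single i 1)
          (EuclideanSpace.single j 1)) = 0 := by
  have hn' : (n : ℝ) ≠ 0 := Nat.cast_ne_zero.2 hn
  have hμ := (Real.sqrt_pos.2 hf).ne'
  have hY : pseudoInner 2 w (conformalPosition c x p (basePoint n p)) = 0 := by
    rw [conformalPosition, pseudoInner_smul_right, hw, mul_zero]
  have hYd : ∀ k, pseudoInner 2 w (pd k (conformalPosition c x p) (basePoint n p)) = 0 := by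
    intro k
    rw [pd, fderiv_conformalPosition h hu hf, pseudoInner_add_right, pseudoInner_smul_right,
      pseudoInner_smul_right, hw, hwd, mul_zero, mul_zero, add_zero]
  have hL := pseudoInner_laplacian_mul hf.ne' (h.det_ne_zero _ hu) (conformalPosition c x p) w hYd
  rw [conformalN, pseudoInner_sub_right, pseudoInner_smul_right, pseudoInner_smul_right, hY,
    mul_zero, sub_zero]
  unfold conformalMetric
  rw [hL]
  simp only [pseudoInner_hess_conformalPosition h hu hf hw hwd, mul_left_comm _
    (Real.sqrt _), ← Finset.mul_sum]
  simp [hn', hμ, hf.ne']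

/-- Orthogonality to Y and dY confines ξ to the span of y and dσ(e); unit length and orientation fix
the coefficient of dσ(e), and the trace condition from N fixes that of y. So ξ exists and is unique,
which removes the quantifier over ξ in `HasConformalPrincipalCurvature`. -/
theorem isConformalNormal_iff (hn : n ≠ 0)
    (he : IsConeNormal 2 (lift c x p) (basePoint n p) (fderiv ℝ (coneLift c) (x p) e))
    {ξ : Fin (n + 3) → ℝ} :
    IsConformalNormal c x p e ξ ↔ ξ = fderiv ℝ (coneLift c) (x p) e
      - meanCurvature 2 (lift c x p) (fderiv ℝ (coneLift c) (x p) e) (basePoint n p) •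
        lift c x p (basePoint n p) := by
  set ê := fderiv ℝ (coneLift c) (x p) e with hê
  set u := basePoint n p with hudef
  set y := lift c x p with hy
  set H := meanCurvature 2 y ê u with hH
  have hn' : (n : ℝ) ≠ 0 := Nat.cast_ne_zero.2 hn
  have hμ := (Real.sqrt_pos.2 hf).ne'
  have hyy := h.null u hu
  have hyd := h.pseudoInner_fderiv hu
  have hye := he.orthogonal
  have hey : pseudoInner 2 ê (y u) = 0 := (pseudoInner_comm _ _).trans hye
  have hsum : ∀ a : ℝ, ∑ i, ∑ j, (gram (inducedMetric 2 y) u)⁻¹ i j *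
        pseudoInner 2 (a • y u + ê) (hess y u (EuclideanSpace.single i 1)
          (EuclideanSpace.single j 1)) = -(n * (a + H)) := by
    intro a
    have h1 := h.sum_inv_mul_gram hu
    have h2 : n * H = ∑ i, ∑ j, (gram (inducedMetric 2 y) u)⁻¹ i j *
        gram (fun v => normalSecond 2 y ê v) u i j := by
      rw [hH, meanCurvature]
      field_simp
    rw [mul_add, h2, mul_comm _ a, ← h1]
    simp only [Finset.mul_sum, ← Finset.sum_add_distrib, ← Finset.sum_neg_distrib]
    refine Finset.sum_congr rfl fun i _ => Finset.sum_congr rfl fun j _ => ?_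
    rw [pseudoInner_add_left, pseudoInner_smul_left, pseudoInner_comm (y u),
      h.pseudoInner_hess hu, pseudoInner_comm ê]
    simp only [gram, Matrix.of_apply, normalSecond]
    ring
  have hperp : ∀ a : ℝ, pseudoInner 2 (a • y u + ê) (y u) = 0 ∧
      ∀ X, pseudoInner 2 (a • y u + ê) (fderiv ℝ y u X) = 0 := by
    intro a
    simp only [pseudoInner_add_left, pseudoInner_smul_left, hyy, hey, hyd,
      he.orthogonal_fderiv]
    simp
  constructor
  · intro hξ
    have h1 : pseudoInner 2 ξ (y u) = 0 := by
      have := hξ.orthogonal_Y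
      rw [conformalPosition, pseudoInner_smul_right] at this
      exact (mul_eq_zero.1 this).resolve_left hμ
    have h2 : ∀ X, pseudoInner 2 ξ (fderiv ℝ y u X) = 0 := by
      intro X
      have := hξ.orthogonal_dY X
      rw [fderiv_conformalPosition h hu hf, pseudoInner_add_right, pseudoInner_smul_right,
        pseudoInner_smul_right, h1, mul_zero, add_zero] at this
      exact (mul_eq_zero.1 this).resolve_left hμ
    obtain ⟨a, ha⟩ := h.exists_eq hu he h1 fun i => h2 _
    -- Expanding one factor of ⟨ξ, ξ⟩ = -1 gives ⟨ξ, ê⟩² = 1, and the orientation selects the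
    -- negative root.
    have hb : pseudoInner 2 ξ ê = -1 := by
      have h3 := hξ.unit
      have h4 := hξ.oriented
      conv_lhs at h3 => arg 3; rw [ha]
      rw [pseudoInner_sub_right, pseudoInner_smul_right, pseudoInner_smul_right, h1] at h3
      nlinarith
    rw [hb, neg_one_smul, sub_neg_eq_add] at ha
    have h3 := hξ.orthogonal_N
    rw [pseudoInner_conformalN h hu hf hn h1 h2, ← hy, ← hudef, ha, hsum] at h3
    have h4 : a = -H := by
      rcases mul_eq_zero.1 (neg_eq_zero.1 h3) with h | h
      · exact absurd h hn'
      · linarith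
    rw [ha, h4, neg_smul]
    abel
  · intro hξ
    have hξ' : ξ = (-H) • y u + ê := by rw [hξ, neg_smul]; abel
    obtain ⟨h1, h2⟩ := hperp (-H)
    rw [← hξ'] at h1 h2
    refine ⟨?_, ?_, fun X => ?_, ?_, ?_⟩
    · rw [conformalPosition, pseudoInner_smul_right, ← hy, h1, mul_zero]
    · rw [pseudoInner_conformalN h hu hf hn h1 h2, ← hy, ← hudef, hξ', hsum]
      ring
    · rw [fderiv_conformalPosition h hu hf, pseudoInner_add_right, pseudoInner_smul_right,
        pseudoInner_smul_right, h1, h2, mul_zero, mul_zero, add_zero]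
    · simp only [hξ', pseudoInner_add_left, pseudoInner_smul_left, pseudoInner_add_right,
        pseudoInner_smul_right, hyy, hey, hye, he.unit]
      ring
    · rw [← hê]
      simp only [hξ', pseudoInner_add_left, pseudoInner_smul_left, hye, he.unit]
      norm_num

/-- Because ⟨D²y, y⟩ = -I, the summand -H y of ξ contributes exactly -H I, which makes II traceless.
-/
theorem normalSecond_conformalPosition
    (he : IsConeNormal 2 (lift c x p) (basePoint n p) (fderiv ℝ (coneLift c) (x p) e))
    (X Z : Coord n) :
    normalSecond 2 (conformalPosition c x p) (fderiv ℝ (coneLift c) (x p) e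
      - meanCurvature 2 (lift c x p) (fderiv ℝ (coneLift c) (x p) e) (basePoint n p) •
        lift c x p (basePoint n p)) (basePoint n p) X Z =
    Real.sqrt (conformalFactor c x p (basePoint n p)) *
      tracelessSecond 2 (lift c x p) (fderiv ℝ (coneLift c) (x p) e) (basePoint n p) X Z := by
  have h1 := pseudoInner_hess_conformalPosition h hu hf
    ((pseudoInner_comm _ _).trans he.orthogonal) he.orthogonal_fderiv X Z
  have h2 := pseudoInner_hess_conformalPosition h hu hf (h.null _ hu) (h.pseudoInner_fderiv hu) X Z
  rw [normalSecond, pseudoInner_comm, pseudoInner_sub_left, pseudoInner_smul_left, h1, h2,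
    pseudoInner_comm (lift c x p (basePoint n p)), h.pseudoInner_hess hu, tracelessSecond,
    normalSecond, pseudoInner_comm (fderiv ℝ (coneLift c) (x p) e)]
  ring

theorem hasConformalPrincipalCurvature_iff (hn : n ≠ 0)
    (he : IsConeNormal 2 (lift c x p) (basePoint n p) (fderiv ℝ (coneLift c) (x p) e))
    (X : TangentSpace (𝓡 n) p) (b : ℝ) :
    HasConformalPrincipalCurvature c x p e X b ↔ X ≠ 0 ∧ ∀ Z : Coord n,
      Real.sqrt (conformalFactor c x p (basePoint n p)) *
        tracelessSecond 2 (lift c x p) (fderiv ℝ (coneLift c) (x p) e) (basePoint n p) X Z =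
      b * (conformalFactor c x p (basePoint n p) *
        inducedMetric 2 (lift c x p) (basePoint n p) X Z) := by
  have key := normalSecond_conformalPosition h hu hf he
  constructor
  · rintro ⟨hX, ξ, hξ, hB⟩
    obtain rfl := (isConformalNormal_iff h hu hf hn he).1 hξ
    exact ⟨hX, fun Z => (key X Z).symm.trans (hB Z)⟩
  · rintro ⟨hX, hB⟩
    exact ⟨hX, _, (isConformalNormal_iff h hu hf hn he).2 rfl, fun Z => (key X Z).trans (hB Z)⟩

end ConformalSecondForm

/-! ## The light cone model -/

section Cone

variable {c : SignType} {n : ℕ}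

/-- The function with `⟨σ(v), σ(w)⟩ = ⟨v, w⟩ - coneShift v - coneShift w`. -/
def coneShift (c : SignType) {n : ℕ} (v : Ambient c n) : ℝ :=
  match c, v with
  | .zero, v => ambientInner .zero v v / 2
  | .pos, _ => 1 / 2
  | .neg, _ => -(1 / 2)

/-- The identity holds on the whole ambient space and couples v and w only through ⟨v, w⟩. A
derivative in v followed by one in w therefore sees nothing else. -/
theorem pseudoInner_coneLift (v w : Ambient c n) :
    pseudoInner 2 (coneLift c v) (coneLift c w) =
      ambientInner c v w - coneShift c v - coneShift c w := by
  cases c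
  · change (Fin (n + 1) → ℝ) at v w
    change pseudoInner (m := n + 1 + 1 + 1) 2
      (Fin.cons (α := fun _ => ℝ) ((pseudoInner 1 v v + 1) / 2)
        (Fin.snoc (α := fun _ => ℝ) (n := n + 1) v ((pseudoInner 1 v v - 1) / 2)))
      (Fin.cons (α := fun _ => ℝ) ((pseudoInner 1 w w + 1) / 2)
        (Fin.snoc (α := fun _ => ℝ) (n := n + 1) w ((pseudoInner 1 w w - 1) / 2))) =
      pseudoInner 1 v w - pseudoInner 1 v v / 2 - pseudoInner 1 w w / 2
    generalize pseudoInner 1 v v = a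
    generalize pseudoInner 1 w w = b
    simp only [pseudoInner]
    rw [Fin.sum_univ_succ, Fin.sum_univ_castSucc]
    simp
    ring
  · change (Fin (n + 2) → ℝ) at v w
    change pseudoInner (m := n + 2 + 1) 2 (Fin.snoc (α := fun _ => ℝ) (n := n + 2) v 1)
      (Fin.snoc (α := fun _ => ℝ) (n := n + 2) w 1) =
      pseudoInner 2 v w - -(1 / 2) - -(1 / 2)
    simp only [pseudoInner]
    rw [Fin.sum_univ_castSucc]
    simp
    ring
  · change (Fin (n + 2) → ℝ) at v w
    change pseudoInner (m := n + 2 + 1) 2 (Fin.cons (α := fun _ => ℝ) (n := n + 2) 1 v)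
      (Fin.cons (α := fun _ => ℝ) (n := n + 2) 1 w) =
      pseudoInner 1 v w - 1 / 2 - 1 / 2
    simp only [pseudoInner]
    rw [Fin.sum_univ_succ]
    simp
    ring

theorem contDiff_of_eq {E F : Type*} [NormedAddCommGroup E] [NormedSpace ℝ E]
    [NormedAddCommGroup F] [NormedSpace ℝ F] {f g : E → F} {k : WithTop ℕ∞}
    (hf : ContDiff ℝ k f) (h : ∀ v, g v = f v) : ContDiff ℝ k g :=
  (funext h : g = f) ▸ hf

theorem contDiff_coneLift : ContDiff ℝ ∞ (coneLift c (n := n)) := by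
  rw [contDiff_pi]
  have hproj : ∀ {m : ℕ} (j : Fin m), ContDiff ℝ ∞ fun v : Fin m → ℝ => v j := fun j =>
    contDiff_apply ℝ ℝ j
  cases c
  · have hq : ContDiff ℝ ∞ fun v : Fin (n + 1) → ℝ => pseudoInner 1 v v :=
      contDiff_iff_contDiffAt.2 fun v => ContDiffAt.pseudoInner contDiffAt_id contDiffAt_id
    intro i
    refine Fin.cases ?_ (fun i => ?_) i
    · exact (hq.add contDiff_const).div_const 2
    · refine Fin.lastCases ?_ (fun i => ?_) i
      · have := (hq.sub (contDiff_const (c := (1 : ℝ)))).div_const 2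
        exact contDiff_of_eq this fun v => Fin.snoc_last (α := fun _ => ℝ) _ _
      · exact contDiff_of_eq (hproj (m := n + 1) i) fun v => Fin.snoc_castSucc (α := fun _ => ℝ) _ v _
  · intro i
    refine Fin.lastCases ?_ (fun i => ?_) i
    · exact contDiff_of_eq (contDiff_const (c := (1 : ℝ))) fun v =>
        Fin.snoc_last (α := fun _ => ℝ) (n := n + 2) _ v
    · exact contDiff_of_eq (hproj (m := n + 2) i) fun v =>
        Fin.snoc_castSucc (α := fun _ => ℝ) (n := n + 2) _ v _
  · intro i
    refine Fin.cases ?_ (fun i => ?_) i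
    · exact contDiff_const
    · exact hproj (m := n + 2) i

theorem coneLift_ne_zero (v : Ambient c n) : coneLift c v ≠ 0 := by
  intro h
  cases c
  · have h0 : (ambientInner .zero v v + 1) / 2 = 0 := congrFun h 0
    have h1 : (ambientInner .zero v v - 1) / 2 = 0 := by
      have := congrFun h (Fin.last (n + 1)).succ
      simp only [coneLift, Fin.cons_succ] at this
      exact (Fin.snoc_last (α := fun _ => ℝ) _ _).symm.trans this
    linarith
  · exact one_ne_zero ((Fin.snoc_last (α := fun _ => ℝ) (n := n + 2) (1 : ℝ) v).symm.trans
      (congrFun h (Fin.last (n + 2))))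
  · exact one_ne_zero (congrFun h 0)

theorem differentiable_coneLift : Differentiable ℝ (coneLift c (n := n)) :=
  contDiff_coneLift.differentiable (by simp)

theorem fderiv_ambientInner_const (v a w : Ambient c n) :
    fderiv ℝ (fun v => ambientInner c v w) v a = ambientInner c a w := by
  have := fderiv_pseudoInner (s := ambientIndex c) (F := fun v : Ambient c n => v)
    (G := fun _ => w) (u := v) differentiableAt_id (differentiableAt_const w) a
  simpa [pseudoInner_zero_right, ambientInner] using this

theorem contDiff_ambientInner_self : ContDiff ℝ ∞ fun v : Ambient c n => ambientInner c v v :=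
  contDiff_iff_contDiffAt.2 fun _ => ContDiffAt.pseudoInner (F := fun v => v) (G := fun v => v)
    contDiffAt_id contDiffAt_id

theorem fderiv_ambientInner_self (v a : Ambient c n) :
    fderiv ℝ (fun v => ambientInner c v v) v a = 2 * ambientInner c v a := by
  have h := fderiv_pseudoInner (s := ambientIndex c) (F := fun v : Ambient c n => v)
    (G := fun v => v) (u := v) differentiableAt_id differentiableAt_id a
  refine h.trans ?_
  rw [fderiv_fun_id]
  change pseudoInner _ a v + pseudoInner _ v a = 2 * pseudoInner _ v a
  rw [pseudoInner_comm a v]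
  ring

theorem differentiable_ambientInner_self :
    Differentiable ℝ fun v : Ambient c n => ambientInner c v v :=
  contDiff_ambientInner_self.differentiable (by simp)

theorem differentiable_coneShift : Differentiable ℝ (coneShift c (n := n)) := by
  cases c
  · change Differentiable ℝ fun v : Ambient .zero n => ambientInner .zero v v / 2
    simp only [div_eq_mul_inv]
    exact differentiable_ambientInner_self.mul_const _
  · exact differentiable_const _
  · exact differentiable_const _

theorem differentiable_ambientInner_left (w : Ambient c n) :
    Differentiable ℝ fun v => ambientInner c v w := fun _ =>
  differentiableAt_of_contDiffAt (ContDiffAt.pseudoInner contDiffAt_id contDiffAt_const)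

theorem pseudoInner_coneLift_fderiv (v a w : Ambient c n) :
    pseudoInner 2 (fderiv ℝ (coneLift c) v a) (coneLift c w) =
      ambientInner c a w - fderiv ℝ (coneShift c) v a := by
  have h1 := fderiv_pseudoInner (s := 2) (differentiable_coneLift v)
    (differentiableAt_const (coneLift c w)) a
  simp only [pseudoInner_coneLift, fderiv_fun_const, Pi.zero_apply, zero_apply,
    pseudoInner_zero_right, add_zero] at h1
  rw [← h1, fderiv_sub_const, fderiv_fun_sub (differentiable_ambientInner_left w v)
    (differentiable_coneShift v)]
  simp [fderiv_ambientInner_const]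

/-- The map to the light cone has isometric differentials, also at different points. -/
theorem pseudoInner_fderiv_coneLift (v w a b : Ambient c n) :
    pseudoInner 2 (fderiv ℝ (coneLift c) v a) (fderiv ℝ (coneLift c) w b) =
      ambientInner c a b := by
  have h1 := fderiv_pseudoInner (s := 2) (differentiableAt_const (fderiv ℝ (coneLift c) v a))
    (differentiable_coneLift w) b
  simp only [pseudoInner_coneLift_fderiv, fderiv_fun_const, Pi.zero_apply, zero_apply,
    pseudoInner_zero_left, zero_add] at h1
  rw [← h1, fderiv_sub_const]
  have h2 : ambientInner c a = fun w => ambientInner c w a :=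
    funext fun w => pseudoInner_comm _ _
  rw [h2, fderiv_ambientInner_const]

theorem coneShift_eq {v : Ambient c n} (hv : v ∈ spaceForm c n) :
    coneShift c v = ambientInner c v v / 2 := by
  cases c
  · rfl
  · change ambientInner .neg v v = -1 at hv
    change -(1 / 2 : ℝ) = ambientInner .neg v v / 2
    rw [hv]; ring
  · change ambientInner .pos v v = 1 at hv
    change (1 / 2 : ℝ) = ambientInner .pos v v / 2
    rw [hv]

theorem fderiv_coneShift {v a : Ambient c n} (ha : a ∈ spaceFormTangent c v) :
    fderiv ℝ (coneShift c) v a = ambientInner c v a := by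
  cases c
  · have h2 : (coneShift .zero (n := n)) = fun v => (2⁻¹ : ℝ) * ambientInner .zero v v := by
      funext v
      change ambientInner .zero v v / 2 = _
      ring
    rw [h2, fderiv_const_mul (differentiable_ambientInner_self v), smul_apply,
      fderiv_ambientInner_self, smul_eq_mul]
    ring
  · refine Eq.trans ?_ (Eq.symm ha)
    have : (coneShift .neg (n := n)) = fun _ => -(1 / 2 : ℝ) := rfl
    rw [this]
    simp
  · refine Eq.trans ?_ (Eq.symm ha)
    have : (coneShift .pos (n := n)) = fun _ => (1 / 2 : ℝ) := rfl
    rw [this]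
    simp

theorem pseudoInner_coneLift_self {v : Ambient c n} (hv : v ∈ spaceForm c n) :
    pseudoInner 2 (coneLift c v) (coneLift c v) = 0 := by
  rw [pseudoInner_coneLift, coneShift_eq hv]
  ring

theorem pseudoInner_coneLift_fderiv_self {v a : Ambient c n} (ha : a ∈ spaceFormTangent c v) :
    pseudoInner 2 (coneLift c v) (fderiv ℝ (coneLift c) v a) = 0 := by
  rw [pseudoInner_comm, pseudoInner_coneLift_fderiv, fderiv_coneShift ha, sub_eq_zero]
  exact pseudoInner_comm _ _

variable {k : ℕ} {ψ : Coord k → Ambient c n} {u : Coord k}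

theorem fderiv_coneLift_comp (hψ : DifferentiableAt ℝ ψ u) (X : Coord k) :
    fderiv ℝ (fun v => coneLift c (ψ v)) u X = fderiv ℝ (coneLift c) (ψ u) (fderiv ℝ ψ u X) := by
  have := fderiv_comp u (differentiable_coneLift (ψ u)) hψ
  exact congrArg (fun L => L X) this

/-- The differentials of σ preserve products between different points, so dσ_w(e) can be held fixed
while the other factor is differentiated. No second derivative of σ appears. -/
theorem pseudoInner_hess_coneLift (hψ : ContDiffAt ℝ ∞ ψ u) (X Z : Coord k)
    (w e : Ambient c n) :
    pseudoInner 2 (hess (fun v => coneLift c (ψ v)) u X Z) (fderiv ℝ (coneLift c) w e) =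
      ambientInner c (hess ψ u X Z) e := by
  have hσψ : ContDiffAt ℝ ∞ (fun v => coneLift c (ψ v)) u :=
    contDiff_coneLift.contDiffAt.comp u hψ
  have h1 : (fun v => pseudoInner 2 (fderiv ℝ (fun v => coneLift c (ψ v)) v Z)
      (fderiv ℝ (coneLift c) w e)) =ᶠ[nhds u] fun v => ambientInner c (fderiv ℝ ψ v Z) e := by
    filter_upwards [eventually_differentiableAt hψ] with v hv
    rw [fderiv_coneLift_comp hv, pseudoInner_fderiv_coneLift]
  have h2 := fderiv_pseudoInner (s := 2) (differentiableAt_of_contDiffAt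
    (ContDiffAt.fderiv_apply_const hσψ Z))
    (differentiableAt_const (fderiv ℝ (coneLift c) w e)) X
  have h3 := fderiv_pseudoInner (s := ambientIndex c) (differentiableAt_of_contDiffAt
    (ContDiffAt.fderiv_apply_const hψ Z)) (differentiableAt_const e) X
  rw [h1.fderiv_eq] at h2
  simp only [fderiv_fun_const, Pi.zero_apply, zero_apply, pseudoInner_zero_right,
    add_zero] at h2 h3
  exact h2.symm.trans h3

end Cone

/-! ## Conformal maps of space forms -/

section Koszul

variable {E : Type*} [NormedAddCommGroup E] [NormedSpace ℝ E] {s m : ℕ} {F F' : E → Fin m → ℝ}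
  {u : E}

theorem fderiv_pullback (hF : ContDiffAt ℝ ∞ F u) (a b d : E) :
    fderiv ℝ (fun v => pseudoInner s (fderiv ℝ F v b) (fderiv ℝ F v d)) u a =
      pseudoInner s (fderiv ℝ (fderiv ℝ F) u a b) (fderiv ℝ F u d)
        + pseudoInner s (fderiv ℝ (fderiv ℝ F) u a d) (fderiv ℝ F u b) := by
  rw [fderiv_pseudoInner (differentiableAt_of_contDiffAt (ContDiffAt.fderiv_apply_const hF b))
    (differentiableAt_of_contDiffAt (ContDiffAt.fderiv_apply_const hF d)), hess_eq hF, hess_eq hF,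
    pseudoInner_comm (fderiv ℝ F u b)]

/-- The Koszul formula in a pseudo-Euclidean space. -/
theorem koszul (hF : ContDiffAt ℝ ∞ F u) (v w e : E) :
    2 * pseudoInner s (fderiv ℝ (fderiv ℝ F) u v w) (fderiv ℝ F u e) =
      fderiv ℝ (fun z => pseudoInner s (fderiv ℝ F z w) (fderiv ℝ F z e)) u v
      + fderiv ℝ (fun z => pseudoInner s (fderiv ℝ F z v) (fderiv ℝ F z e)) u w
      - fderiv ℝ (fun z => pseudoInner s (fderiv ℝ F z v) (fderiv ℝ F z w)) u e := by
  rw [fderiv_pullback hF, fderiv_pullback hF, fderiv_pullback hF, fderiv_fderiv_comm hF w v,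
    fderiv_fderiv_comm hF e v, fderiv_fderiv_comm hF e w]
  ring

/-- The change of the normal part of the second derivative when the pulled back scalar product is
multiplied by a function. -/
theorem pseudoInner_fderiv_fderiv_of_conformal (hF : ContDiffAt ℝ ∞ F u)
    (hF' : ContDiffAt ℝ ∞ F' u) {f : E → ℝ} (hf : DifferentiableAt ℝ f u)
    (hc : ∀ᶠ z in nhds u, ∀ a b, pseudoInner s (fderiv ℝ F' z a) (fderiv ℝ F' z b) =
      f z * pseudoInner s (fderiv ℝ F z a) (fderiv ℝ F z b))
    {v w e : E} (hv : pseudoInner s (fderiv ℝ F u v) (fderiv ℝ F u e) = 0)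
    (hw : pseudoInner s (fderiv ℝ F u w) (fderiv ℝ F u e) = 0) :
    pseudoInner s (fderiv ℝ (fderiv ℝ F') u v w) (fderiv ℝ F' u e) =
      f u * pseudoInner s (fderiv ℝ (fderiv ℝ F) u v w) (fderiv ℝ F u e)
        - fderiv ℝ f u e / 2 * pseudoInner s (fderiv ℝ F u v) (fderiv ℝ F u w) := by
  have hd : ∀ a b d : E,
      fderiv ℝ (fun z => pseudoInner s (fderiv ℝ F' z b) (fderiv ℝ F' z d)) u a =
      f u * fderiv ℝ (fun z => pseudoInner s (fderiv ℝ F z b) (fderiv ℝ F z d)) u a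
        + fderiv ℝ f u a * pseudoInner s (fderiv ℝ F u b) (fderiv ℝ F u d) := by
    intro a b d
    have h1 : (fun z => pseudoInner s (fderiv ℝ F' z b) (fderiv ℝ F' z d)) =ᶠ[nhds u]
        fun z => f z * pseudoInner s (fderiv ℝ F z b) (fderiv ℝ F z d) :=
      hc.mono fun z hz => hz b d
    rw [h1.fderiv_eq, fderiv_fun_mul hf (differentiableAt_of_contDiffAt
      (ContDiffAt.pseudoInner (ContDiffAt.fderiv_apply_const hF b)
        (ContDiffAt.fderiv_apply_const hF d)))]
    simp only [add_apply, smul_apply, smul_eq_mul]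
    ring
  have h1 := koszul (s := s) hF v w e
  have h2 := koszul (s := s) hF' v w e
  -- The derivatives of f along v and w are multiplied by products with dF(e) that vanish; only the
  -- derivative along e survives.
  rw [hd, hd, hd, hv, hw] at h2
  linear_combination (1 / 2) * h2 - (f u / 2) * h1

theorem fderiv_fderiv_comp {V : Type*} [NormedAddCommGroup V] [NormedSpace ℝ V]
    {W : Type*} [NormedAddCommGroup W] [NormedSpace ℝ W] {F : V → W} {ψ : E → V}
    (hF : ContDiffAt ℝ ∞ F (ψ u)) (hψ : ContDiffAt ℝ ∞ ψ u) (X Z : E) :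
    fderiv ℝ (fderiv ℝ fun v => F (ψ v)) u X Z =
      fderiv ℝ (fderiv ℝ F) (ψ u) (fderiv ℝ ψ u X) (fderiv ℝ ψ u Z)
        + fderiv ℝ F (ψ u) (fderiv ℝ (fderiv ℝ ψ) u X Z) := by
  have hFψ : ContDiffAt ℝ ∞ (fun v => F (ψ v)) u := hF.comp u hψ
  have h1 : (fun v => fderiv ℝ (fun v => F (ψ v)) v Z) =ᶠ[nhds u]
      fun v => fderiv ℝ F (ψ v) (fderiv ℝ ψ v Z) := by
    filter_upwards [eventually_differentiableAt hψ,
      hψ.continuousAt.eventually (eventually_differentiableAt hF)] with v h1 h2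
    exact congrArg (fun L => L Z) (fderiv_comp v h2 h1)
  have hF1 : DifferentiableAt ℝ (fderiv ℝ F) (ψ u) :=
    differentiableAt_of_contDiffAt (hF.fderiv_right (m := ∞) (by simp))
  have hψ0 := differentiableAt_of_contDiffAt hψ
  have hψ1 := differentiableAt_of_contDiffAt (ContDiffAt.fderiv_apply_const hψ Z)
  have h2 : fderiv ℝ (fun v => fderiv ℝ F (ψ v)) u =
      (fderiv ℝ (fderiv ℝ F) (ψ u)).comp (fderiv ℝ ψ u) := fderiv_comp u hF1 hψ0
  rw [← hess_eq hFψ, h1.fderiv_eq, fderiv_clm_apply (hF1.fun_comp' u hψ0) hψ1]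
  simp only [add_apply, ContinuousLinearMap.comp_apply, ContinuousLinearMap.flip_apply, h2,
    hess_eq hψ]
  rw [add_comm]

end Koszul

/-! ### Tangent spaces and retractions of space forms, and conformal maps between open parts -/

section SpaceForm

variable {c : SignType} {n : ℕ} {E : Type*} [NormedAddCommGroup E] [NormedSpace ℝ E]

/-- The tangent space of the space form as a linear subspace. -/
def tangentSubmodule (c : SignType) {n : ℕ} (u : Ambient c n) : Submodule ℝ (Ambient c n) where
  carrier := spaceFormTangent c u
  zero_mem' := by
    cases c
    · exact Set.mem_univ _
    · exact pseudoInner_zero_right _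
    · exact pseudoInner_zero_right _
  add_mem' := by
    intro a b ha hb
    cases c
    · exact Set.mem_univ _
    · change pseudoInner _ _ _ = 0 at ha hb ⊢
      rw [pseudoInner_add_right, ha, hb, add_zero]
    · change pseudoInner _ _ _ = 0 at ha hb ⊢
      rw [pseudoInner_add_right, ha, hb, add_zero]
  smul_mem' := by
    intro r a ha
    cases c
    · exact Set.mem_univ _
    · change pseudoInner _ _ _ = 0 at ha ⊢
      rw [pseudoInner_smul_right, ha, mul_zero]
    · change pseudoInner _ _ _ = 0 at ha ⊢
      rw [pseudoInner_smul_right, ha, mul_zero]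

theorem fderiv_mem_spaceFormTangent {F : E → Ambient c n} {u : E} (hF : DifferentiableAt ℝ F u)
    (hm : ∀ᶠ v in nhds u, F v ∈ spaceForm c n) (X : E) :
    fderiv ℝ F u X ∈ spaceFormTangent c (F u) := by
  have key : ∀ ε : ℝ, (∀ᶠ v in nhds u, ambientInner c (F v) (F v) = ε) →
      ambientInner c (F u) (fderiv ℝ F u X) = 0 := by
    intro ε h
    have h1 := fderiv_pseudoInner (s := ambientIndex c) hF hF X
    have h2 : (fun v => pseudoInner (ambientIndex c) (F v) (F v)) =ᶠ[nhds u] fun _ => ε := h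
    rw [h2.fderiv_eq, pseudoInner_comm (fderiv ℝ F u X)] at h1
    simp only [fderiv_fun_const, Pi.zero_apply, zero_apply] at h1
    change pseudoInner _ _ _ = 0
    linarith
  cases c
  · exact Set.mem_univ _
  · exact key _ hm
  · exact key _ hm

/-- For c = ±1 every ambient vector is tangent up to a multiple of u, and v is orthogonal to u, so
nondegeneracy of the ambient product applies. -/
theorem eq_zero_of_tangent {u v : Ambient c n} (hu : u ∈ spaceForm c n)
    (hv : v ∈ spaceFormTangent c u)
    (h : ∀ w ∈ spaceFormTangent c u, ambientInner c v w = 0) : v = 0 := by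
  have key : ∀ ε : ℝ, ε * ε = 1 → ambientInner c u u = ε → ambientInner c u v = 0 →
      (∀ w, ambientInner c u w = 0 → ambientInner c v w = 0) → v = 0 := by
    intro ε hε h1 h2 h3
    refine eq_zero_of_pseudoInner_eq_zero (s := ambientIndex c) fun w => ?_
    have h4 := h3 (w - (ε * ambientInner c u w) • u) (by
      simp only [ambientInner] at h1 ⊢
      rw [pseudoInner_sub_right, pseudoInner_smul_right, h1]
      linear_combination -(pseudoInner (ambientIndex c) u w) * hε)
    simp only [ambientInner] at h2 h4
    rw [pseudoInner_sub_right, pseudoInner_smul_right, pseudoInner_comm v u, h2] at h4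
    linarith
  cases c
  · exact eq_zero_of_pseudoInner_eq_zero fun w => h w (Set.mem_univ _)
  · exact key (-1) (by norm_num) hu hv h
  · exact key 1 (by norm_num) hu hv h

/-- For c = ±1 this is the kernel of ⟨u, ·⟩, a functional that is nonzero at u. The count turns
injectivity of dφ into surjectivity. -/
theorem finrank_tangentSubmodule {u : Ambient c n} (hu : u ∈ spaceForm c n) :
    Module.finrank ℝ (tangentSubmodule c u) = n + 1 := by
  have key : ∀ ε : ℝ, ε ≠ 0 → ambientInner c u u = ε → Module.finrank ℝ (Ambient c n) = n + 2 →
      Module.finrank ℝ (LinearMap.ker (pseudoForm (ambientIndex c) _ u)) = n + 1 := by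
    intro ε hε h1 h2
    have h3 := LinearMap.finrank_range_add_finrank_ker (pseudoForm (ambientIndex c) _ u)
    have h4 : LinearMap.range (pseudoForm (ambientIndex c) _ u) = ⊤ :=
      LinearMap.range_eq_top.2 (LinearMap.surjective fun h => hε (by
        rw [← h1]
        exact congrArg (fun L : Ambient c n →ₗ[ℝ] ℝ => L u) h))
    rw [h4, h2, finrank_top, Module.finrank_self] at h3
    omega
  cases c
  · have : tangentSubmodule .zero u = ⊤ := rfl
    rw [this, finrank_top]
    exact Module.finrank_fin_fun ℝ
  · exact key (-1) (by norm_num) hu (Module.finrank_fin_fun ℝ)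
  · exact key 1 (by norm_num) hu (Module.finrank_fin_fun ℝ)

/-- A smooth retraction of a neighborhood of `u` onto the space form. -/
structure IsSpaceFormRetraction (c : SignType) {n : ℕ} (u : Ambient c n)
    (G : Ambient c n → Ambient c n) : Prop where
  contDiffAt : ContDiffAt ℝ ∞ G u
  mem : ∀ᶠ v in nhds u, G v ∈ spaceForm c n
  eq_self : ∀ v ∈ spaceForm c n, G v = v
  fderiv_eq_self : ∀ v ∈ spaceFormTangent c u, fderiv ℝ G u v = v

/-- The identity for c = 0, otherwise the radial projection v ↦ v/√(ε⟨v, v⟩) with ε = ⟨u, u⟩ = ±1,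
whose scaling factor is stationary at u in tangent directions. It extends φ from the space form to
an ambient neighbourhood. -/
theorem exists_isSpaceFormRetraction {u : Ambient c n} (hu : u ∈ spaceForm c n) :
    ∃ G, IsSpaceFormRetraction c u G := by
  have key : ∀ ε : ℝ, ε * ε = 1 → ambientInner c u u = ε → ∃ G : Ambient c n → Ambient c n,
      ContDiffAt ℝ ∞ G u ∧ (∀ᶠ v in nhds u, ambientInner c (G v) (G v) = ε) ∧
      (∀ v, ambientInner c v v = ε → G v = v) ∧
      ∀ v, ambientInner c u v = 0 → fderiv ℝ G u v = v := by
    intro ε hε h1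
    have hq : ContDiffAt ℝ ∞ (fun v : Ambient c n => ε * ambientInner c v v) u :=
      contDiffAt_const.mul contDiff_ambientInner_self.contDiffAt
    have hq1 : ε * ambientInner c u u = 1 := by rw [h1, hε]
    have hr : ContDiffAt ℝ ∞ (fun v : Ambient c n => (Real.sqrt (ε * ambientInner c v v))⁻¹) u :=
      (hq.sqrt (by rw [hq1]; norm_num)).inv (by rw [hq1]; norm_num)
    refine ⟨fun v => (Real.sqrt (ε * ambientInner c v v))⁻¹ • v, hr.smul contDiffAt_id,
      ?_, fun v hv => ?_, fun v hv => ?_⟩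
    · have : ∀ᶠ v in nhds u, 0 < ε * ambientInner c v v :=
        hq.continuousAt.eventually (lt_mem_nhds
          (show 0 < ε * ambientInner c u u by rw [hq1]; exact one_pos))
      filter_upwards [this] with v hv
      have h3 : ε * ambientInner c v v ≠ 0 := hv.ne'
      have h4 := Real.mul_self_sqrt hv.le
      change pseudoInner _ _ _ = ε
      rw [pseudoInner_smul_left, pseudoInner_smul_right]
      change _ * (_ * ambientInner c v v) = ε
      rw [← mul_assoc, ← mul_inv, h4]
      rw [inv_mul_eq_iff_eq_mul₀ h3]
      linear_combination (-ambientInner c v v) * hε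
    · change (Real.sqrt (ε * ambientInner c v v))⁻¹ • v = v
      rw [hv, hε, Real.sqrt_one, inv_one, one_smul]
    · have hd : fderiv ℝ (fun v : Ambient c n => (Real.sqrt (ε * ambientInner c v v))⁻¹) u v =
          0 := by
        have hq0 : fderiv ℝ (fun v : Ambient c n => ε * ambientInner c v v) u v = 0 := by
          rw [fderiv_const_mul (differentiable_ambientInner_self u), smul_apply,
            fderiv_ambientInner_self, hv]
          simp
        have hcomp : HasDerivAt (fun t : ℝ => (Real.sqrt t)⁻¹) _ (ε * ambientInner c u u) :=
          (Real.hasDerivAt_sqrt (by rw [hq1]; norm_num)).inv (by rw [hq1]; norm_num)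
        have := hcomp.comp_hasFDerivAt u (differentiableAt_of_contDiffAt hq).hasFDerivAt
        have h5 := congrArg (fun L => L v) this.fderiv
        refine h5.trans ?_
        rw [smul_apply, hq0, smul_zero]
      have hd' := differentiableAt_of_contDiffAt hr
      rw [fderiv_fun_smul hd' differentiableAt_fun_id]
      simp [hd, hq1]
  cases c
  · exact ⟨id, contDiffAt_id, Filter.Eventually.of_forall fun _ => Set.mem_univ _,
      fun _ _ => rfl, fun v _ => by rw [fderiv_id]; rfl⟩
  · obtain ⟨G, h1, h2, h3, h4⟩ := key (-1) (by norm_num) hu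
    exact ⟨G, h1, h2, h3, h4⟩
  · obtain ⟨G, h1, h2, h3, h4⟩ := key 1 (by norm_num) hu
    exact ⟨G, h1, h2, h3, h4⟩

theorem IsConformalMapOn.contDiffAt {U : Set (Ambient c n)} {φ : Ambient c n → Ambient c n}
    (hφ : IsConformalMapOn c U φ) {u : Ambient c n} (hu : u ∈ U) : ContDiffAt ℝ ∞ φ u :=
  hφ.contDiffOn.contDiffAt (hφ.isOpen.mem_nhds hu)

/-- The second fundamental form of the image under a conformal map. -/
theorem IsConformalMapOn.exists_hess_comp {U : Set (Ambient c n)} {φ : Ambient c n → Ambient c n}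
    (hφ : IsConformalMapOn c U φ) {k : ℕ} {ψ : Coord k → Ambient c n} {q : Coord k}
    (hψ : ContDiffAt ℝ ∞ ψ q) (hm : ∀ᶠ v in nhds q, ψ v ∈ spaceForm c n) (hU : ψ q ∈ U) {ρ : ℝ}
    (hρ : ∀ v ∈ spaceFormTangent c (ψ q), ∀ w ∈ spaceFormTangent c (ψ q),
      ambientInner c (fderiv ℝ φ (ψ q) v) (fderiv ℝ φ (ψ q) w) = ρ ^ 2 * ambientInner c v w)
    {e : Ambient c n} (he : e ∈ spaceFormTangent c (ψ q)) (hee : ambientInner c e e = -1)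
    (hed : ∀ X, ambientInner c e (fderiv ℝ ψ q X) = 0) :
    ∃ τ : ℝ, ∀ X Z, ambientInner c (hess (fun v => φ (ψ v)) q X Z) (fderiv ℝ φ (ψ q) e) =
      ρ ^ 2 * ambientInner c (hess ψ q X Z) e
        - τ * ambientInner c (fderiv ℝ ψ q X) (fderiv ℝ ψ q Z) := by
  have hmq : ψ q ∈ spaceForm c n := hm.self_of_nhds
  -- Off the space form φ need not be conformal, but the product pulled back by φ ∘ G is a multiple
  -- of the one pulled back by G. These may be degenerate, which the Koszul formula allows.
  obtain ⟨G, hG⟩ := exists_isSpaceFormRetraction hmq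
  have hGq : G (ψ q) = ψ q := hG.eq_self _ hmq
  have hGc : ContDiffAt ℝ ∞ G (ψ q) := hG.contDiffAt
  have hφq : ContDiffAt ℝ ∞ φ (G (ψ q)) := by rw [hGq]; exact hφ.contDiffAt hU
  have hFc : ContDiffAt ℝ ∞ (fun v => φ (G v)) (ψ q) := hφq.comp _ hGc
  have hFd : ∀ᶠ z in nhds (ψ q), G z ∈ U ∧ DifferentiableAt ℝ G z ∧
      ∀ a, fderiv ℝ (fun v => φ (G v)) z a = fderiv ℝ φ (G z) (fderiv ℝ G z a) := by
    filter_upwards [eventually_differentiableAt hGc,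
      hGc.continuousAt.eventually (hφ.isOpen.mem_nhds (hGq.symm ▸ hU))] with z h1 h2
    exact ⟨h2, h1, fun a => congrArg (fun L => L a)
      (fderiv_comp z (differentiableAt_of_contDiffAt (hφ.contDiffAt h2)) h1)⟩
  have hconf : ∀ᶠ z in nhds (ψ q), ∃ r : ℝ, ∀ a b,
      pseudoInner (ambientIndex c) (fderiv ℝ (fun v => φ (G v)) z a)
        (fderiv ℝ (fun v => φ (G v)) z b) =
      r * pseudoInner (ambientIndex c) (fderiv ℝ G z a) (fderiv ℝ G z b) := by
    filter_upwards [hFd, hG.mem, hG.mem.eventually_nhds] with z ⟨h1, h2, h3⟩ h4 h5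
    obtain ⟨r, -, hr⟩ := hφ.conformal (G z) ⟨h1, h4⟩
    refine ⟨r ^ 2, fun a b => ?_⟩
    rw [h3, h3]
    exact hr _ (fderiv_mem_spaceFormTangent h2 h5 a) _ (fderiv_mem_spaceFormTangent h2 h5 b)
  -- The ratio r is given point by point without regularity. Tested on e it equals N'/N near ψ q,
  -- where N is close to -1, and this quotient is smooth.
  set N : Ambient c n → ℝ := fun z =>
    pseudoInner (ambientIndex c) (fderiv ℝ G z e) (fderiv ℝ G z e) with hN
  set N' : Ambient c n → ℝ := fun z =>
    pseudoInner (ambientIndex c) (fderiv ℝ (fun v => φ (G v)) z e)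
      (fderiv ℝ (fun v => φ (G v)) z e) with hN'
  have hNc : ContDiffAt ℝ ∞ N (ψ q) := ContDiffAt.pseudoInner
    (ContDiffAt.fderiv_apply_const hGc e) (ContDiffAt.fderiv_apply_const hGc e)
  have hN'c : ContDiffAt ℝ ∞ N' (ψ q) := ContDiffAt.pseudoInner
    (ContDiffAt.fderiv_apply_const hFc e) (ContDiffAt.fderiv_apply_const hFc e)
  have hNq : N (ψ q) = -1 := by
    rw [hN]
    change pseudoInner _ (fderiv ℝ G (ψ q) e) (fderiv ℝ G (ψ q) e) = -1
    rw [hG.fderiv_eq_self e he]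
    exact hee
  have hFq : ∀ v ∈ spaceFormTangent c (ψ q),
      fderiv ℝ (fun v => φ (G v)) (ψ q) v = fderiv ℝ φ (ψ q) v := by
    intro v hv
    rw [hFd.self_of_nhds.2.2, hG.fderiv_eq_self v hv, hGq]
  have hN'q : N' (ψ q) = -ρ ^ 2 := by
    rw [hN']
    change pseudoInner _ (fderiv ℝ (fun v => φ (G v)) (ψ q) e)
      (fderiv ℝ (fun v => φ (G v)) (ψ q) e) = -ρ ^ 2
    rw [hFq e he]
    refine (hρ e he e he).trans ?_
    rw [hee]
    ring
  have hfd : DifferentiableAt ℝ (fun z => N' z / N z) (ψ q) := differentiableAt_of_contDiffAt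
    (hN'c.div hNc (by rw [hNq]; norm_num))
  have hfc : ∀ᶠ z in nhds (ψ q), ∀ a b,
      pseudoInner (ambientIndex c) (fderiv ℝ (fun v => φ (G v)) z a)
        (fderiv ℝ (fun v => φ (G v)) z b) =
      N' z / N z * pseudoInner (ambientIndex c) (fderiv ℝ G z a) (fderiv ℝ G z b) := by
    have hN0 : ∀ᶠ z in nhds (ψ q), N z ≠ 0 :=
      hNc.continuousAt.eventually_ne (by rw [hNq]; norm_num)
    filter_upwards [hconf, hN0] with z ⟨r, hr⟩ hz a b
    have : N' z / N z = r := by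
      rw [div_eq_iff hz]
      exact hr e e
    rw [this, hr]
  have hψd := differentiableAt_of_contDiffAt hψ
  have hψt : ∀ X, fderiv ℝ ψ q X ∈ spaceFormTangent c (ψ q) :=
    fderiv_mem_spaceFormTangent hψd hm
  -- So τ is half the derivative of the squared conformal ratio along the normal e.
  refine ⟨fderiv ℝ (fun z => N' z / N z) (ψ q) e / 2, fun X Z => ?_⟩
  have hGX : ∀ X, pseudoInner (ambientIndex c) (fderiv ℝ G (ψ q) (fderiv ℝ ψ q X))
      (fderiv ℝ G (ψ q) e) = 0 := by
    intro X
    rw [hG.fderiv_eq_self _ (hψt X), hG.fderiv_eq_self e he, pseudoInner_comm]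
    exact hed X
  have hmain := pseudoInner_fderiv_fderiv_of_conformal hGc hFc hfd hfc (hGX X) (hGX Z)
  -- Near q, ψ and φ ∘ ψ factor through G and φ ∘ G. The chain rule leaves the second derivatives of
  -- these maps, treated in hmain, and their differentials at D²ψ(X, Z), treated in hw. That vector
  -- need not be tangent, which is why hfc is stated for all ambient vectors.
  have hGψ : (fun v => G (ψ v)) =ᶠ[nhds q] ψ := hm.mono fun v hv => hG.eq_self _ hv
  have hFψ : (fun v => φ (G (ψ v))) =ᶠ[nhds q] fun v => φ (ψ v) :=
    hm.mono fun v hv => congrArg φ (hG.eq_self _ hv)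
  have hψF : ContDiffAt ℝ ∞ (fun v => φ (ψ v)) q := (hφ.contDiffAt hU).comp q hψ
  have h1 := fderiv_fderiv_comp hGc hψ X Z
  have h2 := fderiv_fderiv_comp hFc hψ X Z
  rw [hGψ.fderiv.fderiv_eq] at h1
  rw [hFψ.fderiv.fderiv_eq] at h2
  have hw : pseudoInner (ambientIndex c)
      (fderiv ℝ (fun v => φ (G v)) (ψ q) (fderiv ℝ (fderiv ℝ ψ) q X Z))
      (fderiv ℝ (fun v => φ (G v)) (ψ q) e) =
      ρ ^ 2 * pseudoInner (ambientIndex c) (fderiv ℝ G (ψ q) (fderiv ℝ (fderiv ℝ ψ) q X Z))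
        (fderiv ℝ G (ψ q) e) := by
    rw [hfc.self_of_nhds, hNq, hN'q]
    ring
  rw [hNq, hN'q, hG.fderiv_eq_self _ (hψt X), hG.fderiv_eq_self _ (hψt Z)] at hmain
  have hl : ambientInner c (hess (fun v => φ (ψ v)) q X Z) (fderiv ℝ φ (ψ q) e) =
      pseudoInner (ambientIndex c) (fderiv ℝ (fderiv ℝ fun v => φ (ψ v)) q X Z)
        (fderiv ℝ (fun v => φ (G v)) (ψ q) e) := by
    rw [hess_eq_fderiv_fderiv hψF, hFq e he]
    rfl
  have hr : ambientInner c (hess ψ q X Z) e =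
      pseudoInner (ambientIndex c) (fderiv ℝ (fderiv ℝ ψ) q X Z) (fderiv ℝ G (ψ q) e) := by
    rw [hess_eq_fderiv_fderiv hψ, hG.fderiv_eq_self e he]
    rfl
  rw [hl, hr, h1, h2, pseudoInner_add_left, pseudoInner_add_left, hw, hmain]
  simp only [ambientInner]
  ring

/-- The differential of a conformal map is onto the tangent space of the space form. -/
theorem IsConformalMapOn.exists_fderiv_eq {U : Set (Ambient c n)} {φ : Ambient c n → Ambient c n}
    (hφ : IsConformalMapOn c U φ) {u : Ambient c n} (hu : u ∈ U ∩ spaceForm c n) :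
    (∀ v ∈ spaceFormTangent c u, fderiv ℝ φ u v ∈ spaceFormTangent c (φ u)) ∧
    ∀ w ∈ spaceFormTangent c (φ u), ∃ v ∈ spaceFormTangent c u, fderiv ℝ φ u v = w := by
  obtain ⟨G, hG⟩ := exists_isSpaceFormRetraction hu.2
  have hGu : G u = u := hG.eq_self _ hu.2
  have hGc : ContDiffAt ℝ ∞ G u := hG.contDiffAt
  have hφu : ContDiffAt ℝ ∞ φ (G u) := by rw [hGu]; exact hφ.contDiffAt hu.1
  have hm : ∀ᶠ v in nhds u, φ (G v) ∈ spaceForm c n := by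
    filter_upwards [hG.mem, hGc.continuousAt.eventually
      (hφ.isOpen.mem_nhds (hGu.symm ▸ hu.1))] with v h1 h2
    exact hφ.mapsTo ⟨h2, h1⟩
  have hd : ∀ v ∈ spaceFormTangent c u,
      fderiv ℝ (fun v => φ (G v)) u v = fderiv ℝ φ u v := by
    intro v hv
    have := congrArg (fun L => L v) (fderiv_comp u (differentiableAt_of_contDiffAt hφu)
      (differentiableAt_of_contDiffAt hGc))
    refine this.trans ?_
    rw [ContinuousLinearMap.comp_apply, hG.fderiv_eq_self v hv, hGu]
  have hmaps : ∀ v ∈ spaceFormTangent c u, fderiv ℝ φ u v ∈ spaceFormTangent c (φ u) := by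
    intro v hv
    have := fderiv_mem_spaceFormTangent (differentiableAt_of_contDiffAt (hφu.comp u hGc)) hm v
    simp only [Function.comp_apply] at this
    rw [hGu] at this
    rwa [← hd v hv]
  refine ⟨hmaps, fun w hw => ?_⟩
  obtain ⟨ρ, hρ, hconf⟩ := hφ.conformal u hu
  let L : tangentSubmodule c u →ₗ[ℝ] tangentSubmodule c (φ u) :=
    (fderiv ℝ φ u : Ambient c n →ₗ[ℝ] Ambient c n).restrict hmaps
  have hLinj : Function.Injective L := by
    rw [injective_iff_map_eq_zero]
    intro v hv
    have hv0 : fderiv ℝ φ u v = 0 := congrArg Subtype.val hv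
    refine Subtype.ext (eq_zero_of_tangent hu.2 v.2 fun w hw => ?_)
    have := hconf v v.2 w hw
    rw [hv0, ambientInner, pseudoInner_zero_left] at this
    exact (mul_eq_zero.1 this.symm).resolve_left (pow_ne_zero 2 hρ.ne')
  have hLsurj : Function.Surjective L :=
    (LinearMap.injective_iff_surjective_of_finrank_eq_finrank (by
      rw [finrank_tangentSubmodule hu.2, finrank_tangentSubmodule (hφ.mapsTo hu)])).1 hLinj
  obtain ⟨v, hv⟩ := hLsurj ⟨w, hw⟩
  exact ⟨v, v.2, congrArg Subtype.val hv⟩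

end SpaceForm

/-! ## Spacelike hypersurfaces -/

section Traceless

variable {s s' n m m' : ℕ} {y : Coord n → Fin m → ℝ} {y' : Coord n → Fin m' → ℝ}
  {e : Fin m → ℝ} {e' : Fin m' → ℝ} {u : Coord n} {ρ τ : ℝ}

theorem gram_inv_of_conformal (hd : (gram (inducedMetric s y) u).det ≠ 0) (hρ : ρ ≠ 0)
    (hI : ∀ X Z, inducedMetric s' y' u X Z = ρ ^ 2 * inducedMetric s y u X Z) :
    (gram (inducedMetric s' y') u)⁻¹ = (ρ ^ 2)⁻¹ • (gram (inducedMetric s y) u)⁻¹ := by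
  have : gram (inducedMetric s' y') u = ρ ^ 2 • gram (inducedMetric s y) u := by
    ext i j
    exact hI _ _
  rw [this]
  refine Matrix.inv_eq_left_inv ?_
  rw [Matrix.smul_mul, Matrix.mul_smul, smul_smul, inv_mul_cancel₀ (pow_ne_zero 2 hρ), one_smul,
    Matrix.nonsing_inv_mul _ (isUnit_iff_ne_zero.2 hd)]

/-- The summand τ I only changes the mean: H' = ρ⁻² (ρ H + τ), so H' I' absorbs it. -/
theorem tracelessSecond_of_conformal (hn : n ≠ 0)
    (hd : (gram (inducedMetric s y) u).det ≠ 0) (hρ : ρ ≠ 0)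
    (hI : ∀ X Z, inducedMetric s' y' u X Z = ρ ^ 2 * inducedMetric s y u X Z)
    (hII : ∀ X Z, normalSecond s' y' e' u X Z =
      ρ * normalSecond s y e u X Z + τ * inducedMetric s y u X Z) (X Z : Coord n) :
    tracelessSecond s' y' e' u X Z = ρ * tracelessSecond s y e u X Z := by
  have hn' : (n : ℝ) ≠ 0 := Nat.cast_ne_zero.2 hn
  have htr : ∑ i, ∑ j, (gram (inducedMetric s y) u)⁻¹ i j * gram (inducedMetric s y) u i j = n := by
    rw [sum_mul_eq_trace, (gram_inducedMetric_isSymm u).eq,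
      Matrix.nonsing_inv_mul _ (isUnit_iff_ne_zero.2 hd)]
    simp
  have hH : meanCurvature s' y' e' u = (ρ ^ 2)⁻¹ * (ρ * meanCurvature s y e u + τ) := by
    have h1 : ∀ i j, (gram (inducedMetric s' y') u)⁻¹ i j *
        gram (fun v => normalSecond s' y' e' v) u i j =
        (ρ ^ 2)⁻¹ * (ρ * ((gram (inducedMetric s y) u)⁻¹ i j *
          gram (fun v => normalSecond s y e v) u i j)
          + τ * ((gram (inducedMetric s y) u)⁻¹ i j * gram (inducedMetric s y) u i j)) := by
      intro i j
      rw [gram_inv_of_conformal hd hρ hI]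
      have : gram (fun v => normalSecond s' y' e' v) u i j =
          ρ * gram (fun v => normalSecond s y e v) u i j + τ * gram (inducedMetric s y) u i j :=
        hII _ _
      rw [this, Matrix.smul_apply, smul_eq_mul]
      ring
    simp only [meanCurvature, h1, ← Finset.mul_sum, Finset.sum_add_distrib, htr]
    field_simp
  rw [tracelessSecond, tracelessSecond, hH, hI, hII]
  field_simp
  ring

/-- `coneFactor_eq` involves only I and T at u, so relations at one point suffice although the
factor is defined by derivatives of the metric. The trace is quadratic in both I⁻¹ and T, whence ρ⁻⁴
ρ² = ρ⁻². -/
theorem coneFactor_of_conformal {y : Coord n → Fin (n + 3) → ℝ} {y' : Coord n → Fin (n + 3) → ℝ}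
    {e e' : Fin (n + 3) → ℝ} {Ω Ω' : Set (Coord n)} (hn : 2 ≤ n) (h : IsConeImmersion s y Ω)
    (hu : u ∈ Ω) (he : IsConeNormal s y u e) (h' : IsConeImmersion s' y' Ω') (hu' : u ∈ Ω')
    (he' : IsConeNormal s' y' u e') (hρ : ρ ≠ 0)
    (hI : ∀ X Z, inducedMetric s' y' u X Z = ρ ^ 2 * inducedMetric s y u X Z)
    (hII : ∀ X Z, normalSecond s' y' e' u X Z =
      ρ * normalSecond s y e u X Z + τ * inducedMetric s y u X Z) :
    coneFactor s' y' u = (ρ ^ 2)⁻¹ * coneFactor s y u := by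
  have hd := h.det_ne_zero u hu
  have hT : gram (tracelessSecond s' y' e') u = ρ • gram (tracelessSecond s y e) u := by
    ext i j
    exact tracelessSecond_of_conformal (by omega) hd hρ hI hII _ _
  rw [h'.coneFactor_eq hu' hn he', h.coneFactor_eq hu hn he, hT, gram_inv_of_conformal hd hρ hI]
  simp only [Matrix.smul_mul, Matrix.mul_smul, Matrix.trace_smul, smul_eq_mul]
  field_simp

theorem posDef_gram (h : ∀ X, X ≠ 0 → 0 < inducedMetric s y u X X) :
    (gram (inducedMetric s y) u).PosDef := by
  refine Matrix.PosDef.of_dotProduct_mulVec_pos ?_ fun v hv => ?_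
  · rw [Matrix.IsHermitian, Matrix.conjTranspose_eq_transpose_of_trivial]
    exact (gram_inducedMetric_isSymm u).eq
  · have h1 := h (WithLp.toLp 2 v) fun h0 => hv (by simpa using h0)
    obtain ⟨B, hB⟩ := exists_linear_inducedMetric (s := s) (y := y) (u := u)
    rw [← hB, sum_smul_single (WithLp.toLp 2 v)] at h1
    simp only [map_sum, map_smul, LinearMap.sum_apply, LinearMap.smul_apply, smul_eq_mul,
      hB] at h1
    simp only [star_trivial, dotProduct, Matrix.mulVec, Finset.mul_sum]
    refine lt_of_lt_of_eq h1 ?_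
    rw [Finset.sum_comm]
    simp only [Finset.mul_sum]
    refine Finset.sum_congr rfl fun i _ => Finset.sum_congr rfl fun j _ => ?_
    simp only [gram, Matrix.of_apply]
    ring

end Traceless

/-! ### Fundamental forms of a hypersurface and of its lift -/

section Hypersurface

variable {c : SignType} {n : ℕ} {M : Type*} [TopologicalSpace M] [ChartedSpace (Coord n) M]
  {x : M → Ambient c n} {p : M}

theorem basePoint_mem : basePoint n p ∈ (extChartAt (𝓡 n) p).target :=
  mem_extChartAt_target p

theorem chartRep_basePoint : chartRep c x p (basePoint n p) = x p := by
  rw [chartRep, basePoint, extChartAt_to_inv]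

namespace IsSpacelikeHypersurface

variable (hx : IsSpacelikeHypersurface c x)
include hx

theorem chartRep_mem (v : Coord n) : chartRep c x p v ∈ spaceForm c n := hx.mem _

theorem differential_eq (X : TangentSpace (𝓡 n) p) :
    differential c x p X = fderiv ℝ (chartRep c x p) (basePoint n p) X := by
  have h := (hx.contMDiff p).mdifferentiableAt (by simp)
  have h1 : HasFDerivAt (chartRep c x p) (mfderiv (𝓡 n) 𝓘(ℝ, Ambient c n) x p) (basePoint n p) :=
    h.hasMFDerivAt.2.hasFDerivAt (by
      rw [ModelWithCorners.range_eq_univ]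
      exact Filter.univ_mem)
  have h2 : ∀ D : Coord n →L[ℝ] Ambient c n, HasFDerivAt (chartRep c x p) D (basePoint n p) →
      ∀ Y, D Y = fderiv ℝ (chartRep c x p) (basePoint n p) Y := fun D hD Y => by rw [hD.fderiv]
  exact h2 _ h1 X

theorem contDiffAt_chartRep [IsManifold (𝓡 n) ∞ M] {v : Coord n}
    (hv : v ∈ (extChartAt (𝓡 n) p).target) : ContDiffAt ℝ ∞ (chartRep c x p) v := by
  have h1 : ContMDiffOn 𝓘(ℝ, Coord n) 𝓘(ℝ, Ambient c n) ∞ (chartRep c x p)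
      (extChartAt (𝓡 n) p).target :=
    hx.contMDiff.comp_contMDiffOn (contMDiffOn_extChartAt_symm p)
  exact (contMDiffOn_iff_contDiffOn.1 h1).contDiffAt ((isOpen_extChartAt_target p).mem_nhds hv)

theorem differential_mem [IsManifold (𝓡 n) ∞ M] (X : TangentSpace (𝓡 n) p) :
    differential c x p X ∈ spaceFormTangent c (x p) := by
  rw [hx.differential_eq, ← chartRep_basePoint (c := c) (x := x) (p := p)]
  exact fderiv_mem_spaceFormTangent (differentiableAt_of_contDiffAt
    (hx.contDiffAt_chartRep basePoint_mem)) (Filter.Eventually.of_forall hx.chartRep_mem) _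

variable [IsManifold (𝓡 n) ∞ M]

theorem fderiv_lift {v : Coord n} (hv : v ∈ (extChartAt (𝓡 n) p).target) (X : Coord n) :
    fderiv ℝ (lift c x p) v X =
      fderiv ℝ (coneLift c) (chartRep c x p v) (fderiv ℝ (chartRep c x p) v X) :=
  fderiv_coneLift_comp (differentiableAt_of_contDiffAt (hx.contDiffAt_chartRep hv)) X

theorem inducedMetric_lift (X Z : Coord n) :
    inducedMetric 2 (lift c x p) (basePoint n p) X Z = firstForm c x p X Z := by
  rw [inducedMetric, hx.fderiv_lift basePoint_mem, hx.fderiv_lift basePoint_mem,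
    pseudoInner_fderiv_coneLift]
  exact (congrArg₂ (ambientInner c) (hx.differential_eq X) (hx.differential_eq Z)).symm

theorem normalSecond_lift (e : Ambient c n) (X Z : Coord n) :
    normalSecond 2 (lift c x p) (fderiv ℝ (coneLift c) (x p) e) (basePoint n p) X Z =
      secondForm c x p e X Z :=
  congrArg Neg.neg (pseudoInner_hess_coneLift (hx.contDiffAt_chartRep basePoint_mem) X Z (x p) e)

theorem posDef_gram_lift : (gram (inducedMetric 2 (lift c x p)) (basePoint n p)).PosDef :=
  posDef_gram fun X hX => (hx.spacelike p X hX).trans_eq (hx.inducedMetric_lift X X).symm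

theorem exists_isConeImmersion :
    ∃ Ω, basePoint n p ∈ Ω ∧ IsConeImmersion 2 (lift c x p) Ω := by
  have hc : ∀ v ∈ (extChartAt (𝓡 n) p).target, ContDiffAt ℝ ∞ (lift c x p) v := fun v hv =>
    contDiff_coneLift.contDiffAt.comp v (hx.contDiffAt_chartRep hv)
  have hdet : ContinuousOn (fun v => (gram (inducedMetric 2 (lift c x p)) v).det)
      (extChartAt (𝓡 n) p).target := fun v hv =>
    (contDiffAt_det (k := ∞) fun i j => ContDiffAt.pseudoInner (ContDiffAt.pd (hc v hv) i)
      (ContDiffAt.pd (hc v hv) j)).continuousAt.continuousWithinAt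
  -- Positivity of the Gram matrix is only established at the base point; continuity of the
  -- determinant provides an open set.
  refine ⟨(extChartAt (𝓡 n) p).target ∩
    (fun v => (gram (inducedMetric 2 (lift c x p)) v).det) ⁻¹' {0}ᶜ,
    ⟨basePoint_mem, hx.posDef_gram_lift.det_pos.ne'⟩, ?_⟩
  exact
    { isOpen := hdet.isOpen_inter_preimage (isOpen_extChartAt_target p) isOpen_compl_singleton
      contDiffAt := fun v hv => hc v hv.1
      det_ne_zero := fun v hv => hv.2
      ne_zero := fun v _ => coneLift_ne_zero _
      null := fun v _ => pseudoInner_coneLift_self (hx.chartRep_mem v) }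

theorem isConeNormal {e : Ambient c n} (he : IsUnitNormal c x p e) :
    IsConeNormal 2 (lift c x p) (basePoint n p) (fderiv ℝ (coneLift c) (x p) e) where
  orthogonal := by
    rw [lift, chartRep_basePoint]
    exact pseudoInner_coneLift_fderiv_self he.tangent
  orthogonal_fderiv X := by
    rw [hx.fderiv_lift basePoint_mem, pseudoInner_fderiv_coneLift]
    exact (congrArg (ambientInner c e) (hx.differential_eq X)).symm.trans (he.orthogonal X)
  unit := (pseudoInner_fderiv_coneLift _ _ _ _).trans he.unit

/-- Second fundamental forms with respect to different unit normals. -/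
theorem exists_secondForm_eq {e e' : Ambient c n} (he : IsUnitNormal c x p e)
    (he' : IsUnitNormal c x p e') :
    ∃ a b : ℝ, a ≠ 0 ∧ ∀ X Z : TangentSpace (𝓡 n) p,
      secondForm c x p e' X Z = a * secondForm c x p e X Z + b * firstForm c x p X Z := by
  obtain ⟨Ω, hu, h⟩ := hx.exists_isConeImmersion (p := p)
  have hc := hx.isConeNormal he
  have hc' := hx.isConeNormal he'
  obtain ⟨b, hb⟩ := h.exists_eq hu hc ((pseudoInner_comm _ _).trans hc'.orthogonal)
    fun i => hc'.orthogonal_fderiv _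
  set t := pseudoInner 2 (fderiv ℝ (coneLift c) (x p) e') (fderiv ℝ (coneLift c) (x p) e) with ht
  have ht2 : t * t = 1 := by
    have h1 := hc'.unit
    conv_lhs at h1 => arg 3; rw [hb]
    rw [pseudoInner_sub_right, pseudoInner_smul_right, pseudoInner_smul_right,
      pseudoInner_comm _ (lift c x p (basePoint n p)), hc'.orthogonal, ← ht] at h1
    linarith
  -- The coefficient -t is ±1, and the multiple b y contributes b I since ⟨D²y, y⟩ = -I.
  refine ⟨-t, b, fun h0 => ?_, fun X Z => ?_⟩
  · rw [neg_eq_zero] at h0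
    rw [h0] at ht2
    norm_num at ht2
  · have h1 := h.pseudoInner_hess hu X Z
    refine (hx.normalSecond_lift e' X Z).symm.trans (Eq.trans ?_ (congrArg₂ (fun r q => -t * r + b * q)
      (hx.normalSecond_lift e X Z) (hx.inducedMetric_lift X Z)))
    change Coord n at X Z
    rw [normalSecond, hb, pseudoInner_sub_right, pseudoInner_smul_right, pseudoInner_smul_right,
      h1, normalSecond]
    ring

/-- The factor is a positive multiple of |T|², and T = 0 would mean II = H I. -/
theorem coneFactor_pos (hn : 2 ≤ n) {e : Ambient c n} (he : IsUnitNormal c x p e)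
    (hp : ¬ IsUmbilical c x p) : 0 < conformalFactor c x p (basePoint n p) := by
  obtain ⟨Ω, hu, h⟩ := hx.exists_isConeImmersion (p := p)
  have hn1 : (0 : ℝ) < n - 1 := by
    have : (2 : ℝ) ≤ n := by exact_mod_cast hn
    linarith
  rw [conformalFactor_eq_coneFactor, h.coneFactor_eq hu hn (hx.isConeNormal he)]
  refine mul_pos (div_pos (by linarith) hn1) (trace_mul_mul_mul_pos hx.posDef_gram_lift.inv
    (gram_tracelessSecond_isSymm (h.contDiffAt _ hu) _) fun h0 => hp ?_)
  refine ⟨e, he, meanCurvature 2 (lift c x p) (fderiv ℝ (coneLift c) (x p) e) (basePoint n p),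
    fun X Z => ?_⟩
  exact (hx.normalSecond_lift e X Z).symm.trans ((sub_eq_zero.1
    (tracelessSecond_eq_zero (h.contDiffAt _ hu) h0 X Z)).trans
    (congrArg (_ * ·) (hx.inducedMetric_lift X Z)))

end IsSpacelikeHypersurface

/-! ### Unit normals and fundamental forms under a conformal map -/

section Conformal

variable {U : Set (Ambient c n)} {φ : Ambient c n → Ambient c n}
  (hx : IsSpacelikeHypersurface c x) (hφ : IsConformalMapOn c U φ) (hU : ∀ p, x p ∈ U)
include hx hφ hU

theorem IsConformalMapOn.differential_comp (X : TangentSpace (𝓡 n) p) :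
    differential c (φ ∘ x) p X = fderiv ℝ φ (x p) (differential c x p X) := by
  have h1 : MDifferentiableAt 𝓘(ℝ, Ambient c n) 𝓘(ℝ, Ambient c n) φ (x p) :=
    (differentiableAt_of_contDiffAt (hφ.contDiffAt (hU p))).mdifferentiableAt
  have h2 := (hx.contMDiff p).mdifferentiableAt (by simp)
  rw [differential, mfderiv_comp p h1 h2, mfderiv_eq_fderiv]
  rfl

variable [IsManifold (𝓡 n) ∞ M]

theorem IsConformalMapOn.isSpacelikeHypersurface_comp :
    IsSpacelikeHypersurface c (φ ∘ x) where
  contMDiff p := (hφ.contDiffAt (hU p)).contMDiffAt.comp p (hx.contMDiff p)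
  mem p := hφ.mapsTo ⟨hU p, hx.mem p⟩
  spacelike p X hX := by
    obtain ⟨ρ, hρ, hc⟩ := hφ.conformal (x p) ⟨hU p, hx.mem p⟩
    rw [hφ.differential_comp hx hU, hc _ (hx.differential_mem X) _ (hx.differential_mem X)]
    exact mul_pos (pow_pos hρ 2) (hx.spacelike p X hX)

/-- The fundamental forms and unit normals of the image of a hypersurface under a conformal map. -/
theorem IsConformalMapOn.exists_fundamentalForms (p : M) : ∃ ρ : ℝ, 0 < ρ ∧
    (∀ X Z : TangentSpace (𝓡 n) p,
      firstForm c (φ ∘ x) p X Z = ρ ^ 2 * firstForm c x p X Z) ∧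
    (∀ e, IsUnitNormal c x p e → IsUnitNormal c (φ ∘ x) p (ρ⁻¹ • fderiv ℝ φ (x p) e) ∧
      ∃ τ : ℝ, ∀ X Z : TangentSpace (𝓡 n) p,
        secondForm c (φ ∘ x) p (ρ⁻¹ • fderiv ℝ φ (x p) e) X Z =
          ρ * secondForm c x p e X Z + τ * firstForm c x p X Z) ∧
    ∀ e', IsUnitNormal c (φ ∘ x) p e' →
      ∃ e, IsUnitNormal c x p e ∧ e' = ρ⁻¹ • fderiv ℝ φ (x p) e := by
  have hup : x p ∈ U ∩ spaceForm c n := ⟨hU p, hx.mem p⟩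
  obtain ⟨ρ, hρ, hc⟩ := hφ.conformal (x p) hup
  obtain ⟨hmaps, hsurj⟩ := hφ.exists_fderiv_eq hup
  have hρ0 := hρ.ne'
  refine ⟨ρ, hρ, fun X Z => ?_, fun e he => ⟨⟨?_, fun X => ?_, ?_⟩, ?_⟩, fun e' he' => ?_⟩
  · rw [firstForm, hφ.differential_comp hx hU, hφ.differential_comp hx hU]
    exact hc _ (hx.differential_mem X) _ (hx.differential_mem Z)
  · exact (tangentSubmodule c (φ (x p))).smul_mem _ (hmaps e he.tangent)
  · rw [hφ.differential_comp hx hU, ambientInner, pseudoInner_smul_left]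
    change ρ⁻¹ * ambientInner c _ _ = 0
    rw [hc e he.tangent _ (hx.differential_mem X), he.orthogonal, mul_zero, mul_zero]
  · rw [ambientInner, pseudoInner_smul_left, pseudoInner_smul_right]
    change ρ⁻¹ * (ρ⁻¹ * ambientInner c _ _) = -1
    rw [hc e he.tangent e he.tangent, he.unit]
    field_simp
  · have hq : chartRep c x p (basePoint n p) = x p := chartRep_basePoint
    obtain ⟨τ, hτ⟩ := hφ.exists_hess_comp (hx.contDiffAt_chartRep (p := p) basePoint_mem)
      (Filter.Eventually.of_forall hx.chartRep_mem) (ρ := ρ) (e := e) (by rw [hq]; exact hU p)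
      (by rw [hq]; exact hc) (by rw [hq]; exact he.tangent) he.unit
      (fun X => (congrArg (ambientInner c e) (hx.differential_eq X)).symm.trans (he.orthogonal X))
    -- Normalising dφ(e) by ρ⁻¹ turns the coefficient ρ² of II into ρ and τ into ρ⁻¹ τ.
    refine ⟨ρ⁻¹ * τ, fun X Z => ?_⟩
    have h1 := hτ X Z
    rw [hq] at h1
    have h2 : secondForm c (φ ∘ x) p (ρ⁻¹ • fderiv ℝ φ (x p) e) X Z =
        -(ρ⁻¹ * ambientInner c (hess (fun v => φ (chartRep c x p v)) (basePoint n p) X Z)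
          (fderiv ℝ φ (x p) e)) := congrArg Neg.neg (pseudoInner_smul_right _ _ _)
    rw [h2, h1, secondForm, firstForm, hx.differential_eq, hx.differential_eq]
    field_simp
    ring
  · obtain ⟨w, hw, hwe⟩ := hsurj e' he'.tangent
    -- Conformality gives ⟨w, w⟩ = -ρ⁻², hence the factor ρ.
    refine ⟨ρ • w, ⟨(tangentSubmodule c (x p)).smul_mem _ hw, fun X => ?_, ?_⟩, ?_⟩
    · have h1 := he'.orthogonal X
      rw [hφ.differential_comp hx hU, ← hwe, hc w hw _ (hx.differential_mem X)] at h1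
      rw [ambientInner, pseudoInner_smul_left]
      exact mul_eq_zero_of_right _ ((mul_eq_zero.1 h1).resolve_left (pow_ne_zero 2 hρ0))
    · have h1 := he'.unit
      rw [← hwe, hc w hw w hw] at h1
      rw [ambientInner, pseudoInner_smul_left, pseudoInner_smul_right, ← h1, ambientInner]
      ring
    · rw [map_smul, smul_smul, inv_mul_cancel₀ hρ0, one_smul, hwe]

/-- The relation of the fundamental forms for arbitrary unit normals. -/
theorem IsConformalMapOn.exists_secondForm_comp_eq {e e' : Ambient c n}
    (he : IsUnitNormal c x p e) (he' : IsUnitNormal c (φ ∘ x) p e') : ∃ ρ a b : ℝ, 0 < ρ ∧ a ≠ 0 ∧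
    (∀ X Z : TangentSpace (𝓡 n) p,
      firstForm c (φ ∘ x) p X Z = ρ ^ 2 * firstForm c x p X Z) ∧
    ∀ X Z : TangentSpace (𝓡 n) p, secondForm c (φ ∘ x) p e' X Z =
      a * secondForm c x p e X Z + b * firstForm c x p X Z := by
  obtain ⟨ρ, hρ, hI, hII, hN⟩ := hφ.exists_fundamentalForms hx hU p
  obtain ⟨w, hw, rfl⟩ := hN e' he'
  obtain ⟨-, τ, hτ⟩ := hII w hw
  obtain ⟨a, b, ha, hab⟩ := hx.exists_secondForm_eq he hw
  -- Composition of the change of normal from e to w with the affine relation produced by φ.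
  refine ⟨ρ, ρ * a, ρ * b + τ, hρ, mul_ne_zero hρ.ne' ha, hI, fun X Z => ?_⟩
  rw [hτ, hab]
  ring

end Conformal

/-! ### Principal curvatures under an affine change of II -/

section PrincipalCurvatures

variable {x' : M → Ambient c n} {e e' : Ambient c n} {ρ a b : ℝ}

theorem HasPrincipalCurvature.of_conformal (hρ : ρ ≠ 0)
    (hI : ∀ X Z : TangentSpace (𝓡 n) p, firstForm c x' p X Z = ρ ^ 2 * firstForm c x p X Z)
    (hII : ∀ X Z : TangentSpace (𝓡 n) p, secondForm c x' p e' X Z =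
      a * secondForm c x p e X Z + b * firstForm c x p X Z) {X : TangentSpace (𝓡 n) p} {lam : ℝ}
    (h : HasPrincipalCurvature c x p e X lam) :
    HasPrincipalCurvature c x' p e' X ((a * lam + b) / ρ ^ 2) := by
  refine ⟨h.1, fun Z => ?_⟩
  rw [hI, hII, h.2]
  field_simp

theorem HasPrincipalCurvature.of_conformal_symm (ha : a ≠ 0)
    (hI : ∀ X Z : TangentSpace (𝓡 n) p, firstForm c x' p X Z = ρ ^ 2 * firstForm c x p X Z)
    (hII : ∀ X Z : TangentSpace (𝓡 n) p, secondForm c x' p e' X Z =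
      a * secondForm c x p e X Z + b * firstForm c x p X Z) {X : TangentSpace (𝓡 n) p} {lam : ℝ}
    (h : HasPrincipalCurvature c x' p e' X lam) :
    HasPrincipalCurvature c x p e X ((lam * ρ ^ 2 - b) / a) := by
  refine ⟨h.1, fun Z => ?_⟩
  have h1 := h.2 Z
  rw [hI, hII] at h1
  field_simp
  linear_combination h1

theorem mobiusCurvature_affine {k : ℕ} (lam : Fin k → ℝ) {a : ℝ} (ha : a ≠ 0) (b : ℝ)
    {r : ℝ} (hr : r ≠ 0) (i j l : Fin k) :
    mobiusCurvature (fun i => (a * lam i + b) / r) i j l = mobiusCurvature lam i j l := by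
  unfold mobiusCurvature
  have h : ∀ i j, (a * lam i + b) / r - (a * lam j + b) / r = a / r * (lam i - lam j) := by
    intro i j
    ring
  rw [h, h, mul_div_mul_left _ _ (div_ne_zero ha hr)]

end PrincipalCurvatures

/-! ### Umbilical points and conformal principal curvatures under a conformal map -/

section ConformalPrincipalCurvatures

variable [IsManifold (𝓡 n) ∞ M] {U : Set (Ambient c n)} {φ : Ambient c n → Ambient c n}

theorem IsConformalMapOn.not_isUmbilical_comp (hx : IsSpacelikeHypersurface c x)
    (hφ : IsConformalMapOn c U φ) (hU : ∀ p, x p ∈ U) (hp : ¬ IsUmbilical c x p) :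
    ¬ IsUmbilical c (φ ∘ x) p := by
  rintro ⟨e', he', μ, hμ⟩
  obtain ⟨ρ, hρ, hI, hII, hN⟩ := hφ.exists_fundamentalForms hx hU p
  obtain ⟨e, he, rfl⟩ := hN e' he'
  obtain ⟨-, τ, hτ⟩ := hII e he
  -- The solution of ρ II + τ I = μ ρ² I for II.
  refine hp ⟨e, he, (μ * ρ ^ 2 - τ) / ρ, fun X Z => ?_⟩
  have h1 := hμ X Z
  rw [hI, hτ] at h1
  have := hρ.ne'
  field_simp
  linear_combination h1

/-- With r = ρ⁻¹, the quantities T, √f, f and I scale by ρ, ρ⁻¹, ρ⁻² and ρ². Hence √f T and f I are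
the same bilinear forms for x and φ ∘ x, and so are the two eigenvalue equations. -/
theorem IsConformalMapOn.exists_hasConformalPrincipalCurvature_iff
    (hx : IsSpacelikeHypersurface c x) (hφ : IsConformalMapOn c U φ) (hU : ∀ p, x p ∈ U)
    (hn : 2 ≤ n) (hp : ¬ IsUmbilical c x p) {e : Ambient c n} (he : IsUnitNormal c x p e) :
    ∃ r : ℝ, 0 < r ∧ IsUnitNormal c (φ ∘ x) p (r • fderiv ℝ φ (x p) e) ∧
      ∀ (X : TangentSpace (𝓡 n) p) (b : ℝ), HasConformalPrincipalCurvature c x p e X b ↔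
        HasConformalPrincipalCurvature c (φ ∘ x) p (r • fderiv ℝ φ (x p) e) X b := by
  have hn0 : n ≠ 0 := by omega
  have hx' := hφ.isSpacelikeHypersurface_comp hx hU
  obtain ⟨ρ, hρ, hI, hII, -⟩ := hφ.exists_fundamentalForms hx hU p
  obtain ⟨he', τ, hτ⟩ := hII e he
  refine ⟨ρ⁻¹, inv_pos.2 hρ, he', fun X b => ?_⟩
  obtain ⟨Ω, hu, h⟩ := hx.exists_isConeImmersion (p := p)
  obtain ⟨Ω', hu', h'⟩ := hx'.exists_isConeImmersion (p := p)
  have hc := hx.isConeNormal he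
  have hc' := hx'.isConeNormal he'
  have hf := hx.coneFactor_pos hn he hp
  have hf' := hx'.coneFactor_pos hn he' (hφ.not_isUmbilical_comp hx hU hp)
  have hIl : ∀ X Z : Coord n, inducedMetric 2 (lift c (φ ∘ x) p) (basePoint n p) X Z =
      ρ ^ 2 * inducedMetric 2 (lift c x p) (basePoint n p) X Z := fun X Z =>
    (hx'.inducedMetric_lift X Z).trans ((hI X Z).trans
      (congrArg (ρ ^ 2 * ·) (hx.inducedMetric_lift X Z).symm))
  have hIIl : ∀ X Z : Coord n, normalSecond 2 (lift c (φ ∘ x) p)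
      (fderiv ℝ (coneLift c) ((φ ∘ x) p) (ρ⁻¹ • fderiv ℝ φ (x p) e)) (basePoint n p) X Z =
      ρ * normalSecond 2 (lift c x p) (fderiv ℝ (coneLift c) (x p) e) (basePoint n p) X Z
        + τ * inducedMetric 2 (lift c x p) (basePoint n p) X Z := fun X Z =>
    (hx'.normalSecond_lift _ X Z).trans ((hτ X Z).trans
      (congrArg₂ (fun r q => ρ * r + τ * q) (hx.normalSecond_lift e X Z).symm
        (hx.inducedMetric_lift X Z).symm))
  have hT := tracelessSecond_of_conformal hn0 (h.det_ne_zero _ hu) hρ.ne' hIl hIIl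
  have hF : conformalFactor c (φ ∘ x) p (basePoint n p) =
      (ρ ^ 2)⁻¹ * conformalFactor c x p (basePoint n p) :=
    coneFactor_of_conformal hn h hu hc h' hu' hc' hρ.ne' hIl hIIl
  have hS : Real.sqrt (conformalFactor c (φ ∘ x) p (basePoint n p)) =
      ρ⁻¹ * Real.sqrt (conformalFactor c x p (basePoint n p)) := by
    rw [hF, Real.sqrt_mul (by positivity), Real.sqrt_inv, Real.sqrt_sq hρ.le]
  rw [hasConformalPrincipalCurvature_iff h hu hf hn0 hc,
    hasConformalPrincipalCurvature_iff h' hu' hf' hn0 hc', hS, hF]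
  refine and_congr_right fun _ => forall_congr' fun Z => ?_
  have h1 := hT X Z
  have h2 := hIl X Z
  have hρ0 := hρ.ne'
  have h3 : (ρ ^ 2)⁻¹ * ρ ^ 2 = 1 := inv_mul_cancel₀ (pow_ne_zero 2 hρ0)
  rw [h1, h2, ← mul_assoc (ρ⁻¹ * _), mul_right_comm ρ⁻¹, inv_mul_cancel₀ hρ0, one_mul,
    mul_mul_mul_comm, h3, one_mul]

end ConformalPrincipalCurvatures

end Hypersurface

end LorentzConformal

end

/-! ### The invariance theorem -/

theorem mainTheorem8 (c : SignType) (n : ℕ) (hn : 2 ≤ n)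
    {M : Type*} [TopologicalSpace M] [ChartedSpace (EuclideanSpace ℝ (Fin n)) M]
    [IsManifold (𝓡 n) ∞ M]
    (x : M → LorentzConformal.Ambient c n)
    (hx : LorentzConformal.IsSpacelikeHypersurface c x)
    (U : Set (LorentzConformal.Ambient c n))
    (φ : LorentzConformal.Ambient c n → LorentzConformal.Ambient c n)
    (hφ : LorentzConformal.IsConformalMapOn c U φ)
    (hU : ∀ p, x p ∈ U) :
    LorentzConformal.IsSpacelikeHypersurface c (φ ∘ x) ∧
    ∀ p : M,
      -- principal vectors
      (∀ X : TangentSpace (𝓡 n) p,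
        LorentzConformal.IsPrincipalVector c x p X ↔
          LorentzConformal.IsPrincipalVector c (φ ∘ x) p X) ∧
      -- conformal principal curvatures, with their eigenvectors, at points that are not umbilical
      (¬ LorentzConformal.IsUmbilical c x p →
        ¬ LorentzConformal.IsUmbilical c (φ ∘ x) p ∧
        ∀ e, LorentzConformal.IsUnitNormal c x p e →
          ∃ r : ℝ, 0 < r ∧
            LorentzConformal.IsUnitNormal c (φ ∘ x) p (r • fderiv ℝ φ (x p) e) ∧
            ∀ (X : TangentSpace (𝓡 n) p) (b : ℝ),
              LorentzConformal.HasConformalPrincipalCurvature c x p e X b ↔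
                LorentzConformal.HasConformalPrincipalCurvature c (φ ∘ x) p
                  (r • fderiv ℝ φ (x p) e) X b) ∧
      -- Möbius curvatures
      (∀ e e' : LorentzConformal.Ambient c n,
        LorentzConformal.IsUnitNormal c x p e →
        LorentzConformal.IsUnitNormal c (φ ∘ x) p e' →
        ∀ (v : Fin n → TangentSpace (𝓡 n) p) (lam : Fin n → ℝ),
          (∀ i, LorentzConformal.HasPrincipalCurvature c x p e (v i) (lam i)) →
          ∃ lam' : Fin n → ℝ,
            (∀ i, LorentzConformal.HasPrincipalCurvature c (φ ∘ x) p e' (v i) (lam' i)) ∧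
            ∀ i j k, (lam i ≠ lam k ↔ lam' i ≠ lam' k) ∧
              (lam i ≠ lam k →
                LorentzConformal.mobiusCurvature lam i j k =
                  LorentzConformal.mobiusCurvature lam' i j k)) := by
  have hx' := hφ.isSpacelikeHypersurface_comp hx hU
  refine ⟨hx', fun p => ⟨fun X => ⟨?_, ?_⟩, fun hp => ⟨hφ.not_isUmbilical_comp hx hU hp,
    fun e he => hφ.exists_hasConformalPrincipalCurvature_iff hx hU hn hp he⟩, ?_⟩⟩
  · rintro ⟨e, he, lam, h⟩
    obtain ⟨ρ₀, -, -, hII, -⟩ := hφ.exists_fundamentalForms hx hU p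
    obtain ⟨he', -⟩ := hII e he
    obtain ⟨ρ, a, b, hρ, -, hI, hab⟩ := hφ.exists_secondForm_comp_eq hx hU he he'
    exact ⟨_, he', _, h.of_conformal hρ.ne' hI hab⟩
  · rintro ⟨e', he', lam, h⟩
    obtain ⟨ρ₀, -, -, -, hN⟩ := hφ.exists_fundamentalForms hx hU p
    -- The converse needs some unit normal of x; surjectivity of dφ supplies one.
    obtain ⟨e, he, -⟩ := hN e' he'
    obtain ⟨ρ, a, b, -, ha, hI, hab⟩ := hφ.exists_secondForm_comp_eq hx hU he he'
    exact ⟨e, he, _, h.of_conformal_symm ha hI hab⟩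
  · intro e e' he he' v lam h
    obtain ⟨ρ, a, b, hρ, ha, hI, hab⟩ := hφ.exists_secondForm_comp_eq hx hU he he'
    have hr : ρ ^ 2 ≠ 0 := pow_ne_zero 2 hρ.ne'
    refine ⟨fun i => (a * lam i + b) / ρ ^ 2, fun i => (h i).of_conformal hρ.ne' hI hab,
      fun i j k => ⟨not_congr ?_, fun _ =>
        (LorentzConformal.mobiusCurvature_affine lam ha b hr i j k).symm⟩⟩
    rw [div_left_inj' hr, add_left_inj, mul_right_inj' ha]
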